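/- Conventions. Let $k$ be a commutative ring, $\otimes=\otimes_k$, and $\mathcal M_k$ the monoidal category of $k$-modules. An algebra is a $k$-module with an associative $k$-bilinear multiplication, not necessarily unital. An algebra $A$ is idempotent if $A=A^2$ (finite sums of products), non-degenerate if $ab=0$ for all $b\in A$ implies $a=0$ and $ba=0$ for all $b\in A$ implies $a=0$, and $k$-projective if it is projective as a $k$-module. A right $A$-module $M$ is idempotent if $M=MA$ and non-degenerate if $ma=0$ for all $a\in A$ implies $m=0$; similarly on the left. Let $\mathcal M_A$ (resp. ${}_A\mathcal M$) be the category of non-degenerate idempotent $k$-projective right (resp. left) $A$-modules and $A$-linear maps. For algebras $B$ and $P$, a non-degenerate idempotent $k$-projective $B$-extension structure on $P$ is a $B$-bimodule structure on $P$ that is idempotent and non-degenerate on both sides, where $P$ is $k$-projective and the multiplication of $P$ is $B$-bilinear and $B$-balanced, i.e. $(p\cdot b)p'=p(b\cdot p')$. Such $P$, with the $B$-bilinear algebra maps as morphisms, form the category $B\text{-}\mathsf{Ext}$. The tensor product $P\otimes Q$ of two algebras always carries the multiplication $(p\otimes q)(p'\otimes q')=pp'\otimes qq'$. Let $\mathsf{NdI}_k$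 be the category of non-degenerate idempotent $k$-projective algebras in which a morphism $B\to A$ is a non-degenerate idempotent $k$-projective $B$-extension structure on $A$. The composite of $f:B\to A$ and $g:A\to R$ is the $B$-extension structure on $R$ determined by $b\cdot(a\cdot r)=(b\cdot a)\cdot r$ and $(r\cdot a)\cdot b=r\cdot(a\cdot b)$, and the identity of $A$ is $A$ as an extension of itself. $\mathsf{NdI}_k$ is monoidal under the tensor product of algebras and, on morphisms, the componentwise tensor product of actions, with unit $k$ and the usual constraints. A multiplier bialgebra structure on $A$ is a comonoid structure $(\Delta:A\to A\otimes A,\ \varepsilon:A\to k)$ on $A$ in $\mathsf{NdI}_k$. Theorem. Let $A$ be a non-degenerate idempotent $k$-projective algebra. There is a bijective correspondence between multiplier bialgebra structures $(\Delta,\varepsilon)$ on $A$ and triples of monoidal structures on the categories $\mathcal M_A$, ${}_A\mathcal M$ and $A\text{-}\mathsf{Ext}$ such that all the forgetful functors $$A\text{-}\mathsf{Ext}\to{}_A\mathcal M,\qquad A\text{-}\mathsf{Ext}\to\mathcal M_A,\qquad {}_A\mathcal M\to\mathcal M_k,\qquad \mathcal M_A\to\mathcal M_k$$ are strict monoidal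 and the underlying algebras of the tensor product of two extensions $P,Q$ and of the unit object of $A\text{-}\mathsf{Ext}$ are the tensor product algebra $P\otimes Q$ and the algebra $k$. Under this correspondence, the tensor product in $A\text{-}\mathsf{Ext}$ of the canonical extension $A$ with itself is $A\otimes A$ with the extension structure $\Delta$, and the unit object of $A\text{-}\mathsf{Ext}$ is $k$ with the extension structure $\varepsilon$. -/

import Mathlib

open CategoryTheory MonoidalCategory
open scoped TensorProduct

universe u

namespace MultBialg

/-! ### Bilinear maps: idempotency and non-degeneracy -/

section Bilinear

variable {k : Type u} [CommRing k]
variable {M N P M' N' P' : Type u} [AddCommGroup M] [Module k M] [AddCommGroup N] [Module k N]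
  [AddCommGroup P] [Module k P] [AddCommGroup M'] [Module k M'] [AddCommGroup N'] [Module k N']
  [AddCommGroup P'] [Module k P']

/-- A bilinear map (an action or a multiplication) is idempotent when every element of its
target is a finite sum of values. -/
def IsIdem (f : M →ₗ[k] N →ₗ[k] P) : Prop :=
  Submodule.span k {p : P | ∃ m n, f m n = p} = ⊤

/-- `f` is non-degenerate in its first variable: `f m n = 0` for all `n` forces `m = 0`. -/
def NondegFst (f : M →ₗ[k] N →ₗ[k] P) : Prop :=
  ∀ m, (∀ n, f m n = 0) → m = 0

/-- `f` is non-degenerate in its second variable: `f m n = 0` for all `m` forces `n = 0`. -/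
def NondegSnd (f : M →ₗ[k] N →ₗ[k] P) : Prop :=
  ∀ n, (∀ m, f m n = 0) → n = 0

theorem IsIdem.induction {f : M →ₗ[k] N →ₗ[k] P} (hf : IsIdem f) {q : P → Prop}
    (hmul : ∀ m n, q (f m n)) (hadd : ∀ x y, q x → q y → q (x + y)) (p : P) : q p := by
  have hp : p ∈ Submodule.span k {p : P | ∃ m n, f m n = p} := by
    rw [show Submodule.span k {p : P | ∃ m n, f m n = p} = ⊤ from hf]; trivial
  refine Submodule.closure_induction (p := fun x _ => q x) ?_ ?_ ?_ hp
  · simpa using hmul 0 0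
  · intro x y _ _ hx hy; exact hadd x y hx hy
  · rintro r x ⟨m, n, rfl⟩
    simpa using hmul (r • m) n

theorem isIdem_of_mem {f : M →ₗ[k] N →ₗ[k] P} {g : M' →ₗ[k] N' →ₗ[k] P} (hg : IsIdem g)
    (h : ∀ m n, g m n ∈ Submodule.span k {p : P | ∃ m n, f m n = p}) : IsIdem f :=
  eq_top_iff.2 fun p _ => hg.induction (q := fun p => p ∈ Submodule.span k _) h
    (fun _ _ hx hy => Submodule.add_mem _ hx hy) p

theorem IsIdem.map₂ {f : M →ₗ[k] N →ₗ[k] P} {g : M' →ₗ[k] N' →ₗ[k] P'} (hf : IsIdem f)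
    (hg : IsIdem g) : IsIdem (TensorProduct.map₂ f g) := by
  refine eq_top_iff.2 fun x _ => ?_
  induction x with
  | zero => exact Submodule.zero_mem _
  | add x y hx hy => exact Submodule.add_mem _ (hx trivial) (hy trivial)
  | tmul p p' =>
    refine hf.induction (q := fun p => p ⊗ₜ[k] p' ∈ Submodule.span k _) (fun m n => ?_)
      (fun x y hx hy => ?_) p
    · refine hg.induction (q := fun p' => f m n ⊗ₜ[k] p' ∈ Submodule.span k _) (fun m' n' => ?_)
        (fun x y hx hy => ?_) p'
      · exact Submodule.subset_span ⟨m ⊗ₜ m', n ⊗ₜ n', by simp⟩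
      · rw [TensorProduct.tmul_add]; exact Submodule.add_mem _ hx hy
    · rw [TensorProduct.add_tmul]; exact Submodule.add_mem _ hx hy

/-- Functionals on a projective module separate points of a tensor product. -/
theorem eq_zero_of_lTensor [Module.Projective k N] (x : M ⊗[k] N)
    (h : ∀ φ : N →ₗ[k] k, LinearMap.lTensor M φ x = 0) : x = 0 := by
  obtain ⟨s, hs⟩ := (Module.projective_lifting_property
    (Finsupp.linearCombination k (id : N → N)) LinearMap.id
    (Finsupp.linearCombination_id_surjective k N))
  have hinj : Function.Injective (LinearMap.lTensor M s) := by
    refine Function.LeftInverse.injective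
      (g := LinearMap.lTensor M (Finsupp.linearCombination k (id : N → N))) fun y => ?_
    rw [← LinearMap.comp_apply, ← LinearMap.lTensor_comp, hs, LinearMap.lTensor_id]; rfl
  classical
  apply hinj
  rw [map_zero]
  apply (TensorProduct.finsuppScalarRight k k M N).injective
  rw [map_zero]
  ext i
  have h2 : ∀ y : M ⊗[k] N, TensorProduct.finsuppScalarRight k k M N (LinearMap.lTensor M s y) i
      = TensorProduct.rid k M (LinearMap.lTensor M (Finsupp.lapply i ∘ₗ s) y) := by
    intro y
    induction y with
    | zero => simp
    | add a b ha hb => simp only [map_add, Finsupp.add_apply, ha, hb]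
    | tmul m n => simp [TensorProduct.finsuppScalarRight_apply_tmul_apply]
  rw [h2, h]
  simp

theorem eq_zero_of_rTensor [Module.Projective k M] (x : M ⊗[k] N)
    (h : ∀ φ : M →ₗ[k] k, LinearMap.rTensor N φ x = 0) : x = 0 := by
  apply (TensorProduct.comm k M N).injective
  rw [map_zero]
  refine eq_zero_of_lTensor _ fun φ => ?_
  have : ∀ y : M ⊗[k] N, LinearMap.lTensor N φ (TensorProduct.comm k M N y) =
      TensorProduct.comm k k N (LinearMap.rTensor N φ y) := by
    intro y
    induction y with
    | zero => simp
    | add a b ha hb => simp only [map_add, ha, hb]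
    | tmul m n => simp
  rw [this, h, map_zero]

theorem NondegFst.map₂ [Module.Projective k M] [Module.Projective k N]
    {f : M →ₗ[k] M' →ₗ[k] M} {g : N →ₗ[k] N' →ₗ[k] N} (hf : NondegFst f) (hg : NondegFst g) :
    NondegFst (TensorProduct.map₂ f g) := by
  intro x hx
  have h1 : ∀ a, LinearMap.rTensor N (f.flip a) x = 0 := by
    intro a
    refine eq_zero_of_rTensor _ fun ψ => ?_
    rw [← (TensorProduct.lid k N).map_eq_zero_iff]
    refine hg _ fun b => ?_
    have : ∀ y : M ⊗[k] N, g (TensorProduct.lid k N (LinearMap.rTensor N ψ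
        (LinearMap.rTensor N (f.flip a) y))) b = TensorProduct.lid k N (LinearMap.rTensor N ψ
          (TensorProduct.map₂ f g y (a ⊗ₜ b))) := by
      intro y
      induction y with
      | zero => simp
      | add a b ha hb => simp only [map_add, LinearMap.add_apply, ha, hb]
      | tmul m n => simp
    rw [this, hx]; simp
  refine eq_zero_of_lTensor _ fun φ => ?_
  rw [← (TensorProduct.rid k M).map_eq_zero_iff]
  refine hf _ fun a => ?_
  have : ∀ y : M ⊗[k] N, f (TensorProduct.rid k M (LinearMap.lTensor M φ y)) a =
      TensorProduct.rid k M (LinearMap.lTensor M φ (LinearMap.rTensor N (f.flip a) y)) := by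
    intro y
    induction y with
    | zero => simp
    | add a b ha hb => simp only [map_add, LinearMap.add_apply, ha, hb]
    | tmul m n => simp
  rw [this, h1]; simp

theorem nondegSnd_iff_flip {f : M →ₗ[k] N →ₗ[k] P} : NondegSnd f ↔ NondegFst f.flip := Iff.rfl

theorem map₂_flip (f : M →ₗ[k] N →ₗ[k] P) (g : M' →ₗ[k] N' →ₗ[k] P') :
    (TensorProduct.map₂ f g).flip = TensorProduct.map₂ f.flip g.flip := by
  ext; simp

theorem NondegSnd.map₂ [Module.Projective k M] [Module.Projective k N]
    {f : M' →ₗ[k] M →ₗ[k] M} {g : N' →ₗ[k] N →ₗ[k] N} (hf : NondegSnd f) (hg : NondegSnd g) :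
    NondegSnd (TensorProduct.map₂ f g) := by
  rw [nondegSnd_iff_flip, map₂_flip]
  exact NondegFst.map₂ hf hg

section Assoc

variable {Q S T Q' S' T' : Type u} [AddCommGroup Q] [Module k Q] [AddCommGroup S] [Module k S]
  [AddCommGroup T] [Module k T] [AddCommGroup Q'] [Module k Q'] [AddCommGroup S'] [Module k S']
  [AddCommGroup T'] [Module k T']

theorem map₂_assoc {f : M →ₗ[k] N →ₗ[k] Q} {F : Q →ₗ[k] P →ₗ[k] T} {g : N →ₗ[k] P →ₗ[k] S}
    {G : M →ₗ[k] S →ₗ[k] T} {f' : M' →ₗ[k] N' →ₗ[k] Q'} {F' : Q' →ₗ[k] P' →ₗ[k] T'}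
    {g' : N' →ₗ[k] P' →ₗ[k] S'} {G' : M' →ₗ[k] S' →ₗ[k] T'}
    (h : ∀ m n p, F (f m n) p = G m (g n p)) (h' : ∀ m n p, F' (f' m n) p = G' m (g' n p))
    (x : M ⊗[k] M') (y : N ⊗[k] N') (z : P ⊗[k] P') :
    TensorProduct.map₂ F F' (TensorProduct.map₂ f f' x y) z =
      TensorProduct.map₂ G G' x (TensorProduct.map₂ g g' y z) := by
  induction x with
  | zero => simp
  | add a b ha hb => simp only [map_add, LinearMap.add_apply, ha, hb]
  | tmul m m' =>
  induction y with
  | zero => simp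
  | add a b ha hb => simp only [map_add, LinearMap.add_apply, ha, hb]
  | tmul n n' =>
  induction z with
  | zero => simp
  | add a b ha hb => simp only [map_add, ha, hb]
  | tmul p p' => simp [h, h']

theorem assoc_map₂ (f : M →ₗ[k] N →ₗ[k] P) (g : M' →ₗ[k] N' →ₗ[k] P') (h : Q →ₗ[k] S →ₗ[k] T)
    (x : (M ⊗[k] M') ⊗[k] Q) (y : (N ⊗[k] N') ⊗[k] S) :
    TensorProduct.assoc k P P' T (TensorProduct.map₂ (TensorProduct.map₂ f g) h x y) =
      TensorProduct.map₂ f (TensorProduct.map₂ g h) (TensorProduct.assoc k M M' Q x)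
        (TensorProduct.assoc k N N' S y) := by
  induction x with
  | zero => simp
  | add a b ha hb => simp only [map_add, LinearMap.add_apply, ha, hb]
  | tmul x q =>
  induction x with
  | zero => simp
  | add a b ha hb => simp only [TensorProduct.add_tmul, map_add, LinearMap.add_apply, ha, hb]
  | tmul m m' =>
  induction y with
  | zero => simp
  | add a b ha hb => simp only [map_add, ha, hb]
  | tmul y s =>
  induction y with
  | zero => simp
  | add a b ha hb => simp only [TensorProduct.add_tmul, map_add, ha, hb]
  | tmul n n' => simp

theorem lid_map₂ (f : M →ₗ[k] N →ₗ[k] P) (x : k ⊗[k] M) (y : k ⊗[k] N) :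
    TensorProduct.lid k P (TensorProduct.map₂ (LinearMap.mul k k) f x y) =
      f (TensorProduct.lid k M x) (TensorProduct.lid k N y) := by
  induction x with
  | zero => simp
  | add a b ha hb => simp only [map_add, LinearMap.add_apply, ha, hb]
  | tmul x q =>
  induction y with
  | zero => simp
  | add a b ha hb => simp only [map_add, ha, hb]
  | tmul y s => simp [smul_smul, mul_comm]

theorem rid_map₂ (f : M →ₗ[k] N →ₗ[k] P) (x : M ⊗[k] k) (y : N ⊗[k] k) :
    TensorProduct.rid k P (TensorProduct.map₂ f (LinearMap.mul k k) x y) =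
      f (TensorProduct.rid k M x) (TensorProduct.rid k N y) := by
  induction x with
  | zero => simp
  | add a b ha hb => simp only [map_add, LinearMap.add_apply, ha, hb]
  | tmul x q =>
  induction y with
  | zero => simp
  | add a b ha hb => simp only [map_add, ha, hb]
  | tmul y s => simp [smul_smul, mul_comm]

end Assoc

end Bilinear

/-! ### Non-unital algebras -/

/-- A `k`-algebra: a `k`-module with an associative bilinear multiplication (no unit). -/
structure NUAlg (k : Type u) [CommRing k] where
  carrier : ModuleCat.{u} k
  mul : carrier →ₗ[k] carrier →ₗ[k] carrier
  mul_assoc : ∀ a b c, mul (mul a b) c = mul a (mul b c)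

variable {k : Type u} [CommRing k]

namespace NUAlg

/-- The tensor product algebra, `(a ⊗ b)(a' ⊗ b') = aa' ⊗ bb'`. -/
@[reducible] noncomputable def tensor (A B : NUAlg k) : NUAlg k where
  carrier := ModuleCat.of k (A.carrier ⊗[k] B.carrier)
  mul := TensorProduct.map₂ A.mul B.mul
  mul_assoc := map₂_assoc A.mul_assoc B.mul_assoc

/-- The base ring as an algebra. -/
@[reducible] def base (k : Type u) [CommRing k] : NUAlg k where
  carrier := ModuleCat.of k k
  mul := LinearMap.mul k k
  mul_assoc a b c := _root_.mul_assoc (G := k) a b c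

end NUAlg

/-- A non-degenerate idempotent `B`-extension structure on the algebra `A`: a `B`-bimodule
structure on `A`, idempotent and non-degenerate on both sides, for which the multiplication of
`A` is `B`-bilinear and `B`-balanced. -/
@[ext]
structure ExtStr (B A : NUAlg k) where
  left : B.carrier →ₗ[k] A.carrier →ₗ[k] A.carrier
  right : A.carrier →ₗ[k] B.carrier →ₗ[k] A.carrier
  left_mul : ∀ b b' a, left (B.mul b b') a = left b (left b' a)
  right_mul : ∀ a b b', right a (B.mul b b') = right (right a b) b'
  bimod : ∀ b a b', right (left b a) b' = left b (right a b')
  mul_left : ∀ b a a', left b (A.mul a a') = A.mul (left b a) a'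
  mul_right : ∀ a a' b, right (A.mul a a') b = A.mul a (right a' b)
  balanced : ∀ a b a', A.mul (right a b) a' = A.mul a (left b a')
  idem_left : IsIdem left
  idem_right : IsIdem right
  nondeg_left : NondegSnd left
  nondeg_right : NondegFst right

/-- An object of the category of non-degenerate idempotent `k`-projective algebras. -/
structure NdI (k : Type u) [CommRing k] where
  alg : NUAlg k
  projective : Module.Projective k alg.carrier
  idem : IsIdem alg.mul
  nondeg_left : NondegSnd alg.mul
  nondeg_right : NondegFst alg.mul

attribute [instance] NdI.projective

namespace ExtStr

/-- The trivial extension of a non-degenerate idempotent algebra by itself. -/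
def refl (A : NdI k) : ExtStr A.alg A.alg where
  left := A.alg.mul
  right := A.alg.mul
  left_mul := A.alg.mul_assoc
  right_mul a b c := (A.alg.mul_assoc a b c).symm
  bimod := A.alg.mul_assoc
  mul_left b a a' := (A.alg.mul_assoc b a a').symm
  mul_right := A.alg.mul_assoc
  balanced := A.alg.mul_assoc
  idem_left := A.idem
  idem_right := A.idem
  nondeg_left := A.nondeg_left
  nondeg_right := A.nondeg_right

section Comp

variable {B A R : NUAlg k} (f : ExtStr B A) (g : ExtStr A R)

theorem exists_left (b : B.carrier) (r : R.carrier) :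
    ∃ s, ∀ a, g.left a s = g.left (f.right a b) r := by
  refine g.idem_left.induction (q := fun r => ∃ s, ∀ a, g.left a s = g.left (f.right a b) r)
    (fun a' r' => ⟨g.left (f.left b a') r', fun a => ?_⟩) ?_ r
  · rw [← g.left_mul, ← g.left_mul, f.balanced]
  · rintro x y ⟨s, hs⟩ ⟨t, ht⟩
    exact ⟨s + t, fun a => by rw [map_add, map_add, hs, ht]⟩

theorem exists_right (r : R.carrier) (b : B.carrier) :
    ∃ s, ∀ a, g.right s a = g.right r (f.left b a) := by
  refine g.idem_right.induction (q := fun r => ∃ s, ∀ a, g.right s a = g.right r (f.left b a))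
    (fun r' a' => ⟨g.right r' (f.right a' b), fun a => ?_⟩) ?_ r
  · rw [← g.right_mul, ← g.right_mul, f.balanced]
  · rintro x y ⟨s, hs⟩ ⟨t, ht⟩
    exact ⟨s + t, fun a => by rw [map_add, LinearMap.add_apply, hs, ht, map_add,
      LinearMap.add_apply]⟩

theorem ext_left {r s : R.carrier} (h : ∀ a, g.left a r = g.left a s) : r = s :=
  sub_eq_zero.1 (g.nondeg_left _ fun a => by rw [map_sub, h, sub_self])

theorem ext_right {r s : R.carrier} (h : ∀ a, g.right r a = g.right s a) : r = s :=
  sub_eq_zero.1 (g.nondeg_right _ fun a => by rw [map_sub, LinearMap.sub_apply, h, sub_self])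

/-- The left `B`-action on an `A`-extension `R`, determined by `a · (b · r) = (a · b) · r`
(equivalently `b · (a · r) = (b · a) · r`). -/
noncomputable def compLeft : B.carrier →ₗ[k] R.carrier →ₗ[k] R.carrier :=
  LinearMap.mk₂ k (fun b r => (exists_left f g b r).choose)
    (fun b b' r => g.ext_left fun a => by
      rw [map_add, (exists_left f g _ r).choose_spec, (exists_left f g _ r).choose_spec,
        (exists_left f g _ r).choose_spec]; simp)
    (fun t b r => g.ext_left fun a => by
      rw [map_smul, (exists_left f g _ r).choose_spec, (exists_left f g _ r).choose_spec]; simp)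
    (fun b r r' => g.ext_left fun a => by
      rw [map_add, (exists_left f g b _).choose_spec, (exists_left f g b _).choose_spec,
        (exists_left f g b _).choose_spec]; simp)
    (fun t b r => g.ext_left fun a => by
      rw [map_smul, (exists_left f g b _).choose_spec, (exists_left f g b _).choose_spec]; simp)

/-- The right `B`-action on an `A`-extension `R`, determined by `(r · b) · a = r · (b · a)`
(equivalently `(r · a) · b = r · (a · b)`). -/
noncomputable def compRight : R.carrier →ₗ[k] B.carrier →ₗ[k] R.carrier :=
  LinearMap.mk₂ k (fun r b => (exists_right f g r b).choose)
    (fun r r' b => g.ext_right fun a => by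
      rw [(exists_right f g (r + r') b).choose_spec, map_add, map_add, LinearMap.add_apply,
        LinearMap.add_apply, (exists_right f g r b).choose_spec,
        (exists_right f g r' b).choose_spec])
    (fun t r b => g.ext_right fun a => by
      rw [(exists_right f g (t • r) b).choose_spec, map_smul, map_smul, LinearMap.smul_apply,
        LinearMap.smul_apply, (exists_right f g r b).choose_spec])
    (fun r b b' => g.ext_right fun a => by
      rw [(exists_right f g r (b + b')).choose_spec, map_add, map_add, LinearMap.add_apply,
        LinearMap.add_apply, map_add, (exists_right f g r b).choose_spec,
        (exists_right f g r b').choose_spec])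
    (fun t r b => g.ext_right fun a => by
      rw [(exists_right f g r (t • b)).choose_spec, map_smul, map_smul, LinearMap.smul_apply,
        LinearMap.smul_apply, map_smul, (exists_right f g r b).choose_spec])

theorem left_compLeft (a : A.carrier) (b : B.carrier) (r : R.carrier) :
    g.left a (compLeft f g b r) = g.left (f.right a b) r :=
  (exists_left f g b r).choose_spec a

theorem right_compRight (r : R.carrier) (b : B.carrier) (a : A.carrier) :
    g.right (compRight f g r b) a = g.right r (f.left b a) :=
  (exists_right f g r b).choose_spec a

theorem compLeft_left (b : B.carrier) (a : A.carrier) (r : R.carrier) :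
    compLeft f g b (g.left a r) = g.left (f.left b a) r :=
  g.ext_left fun a' => by
    rw [left_compLeft, ← g.left_mul, ← g.left_mul, f.balanced]

theorem compRight_right (r : R.carrier) (a : A.carrier) (b : B.carrier) :
    compRight f g (g.right r a) b = g.right r (f.right a b) :=
  g.ext_right fun a' => by
    rw [right_compRight, ← g.right_mul, ← g.right_mul, f.balanced]

theorem left_compRight (a : A.carrier) (r : R.carrier) (b : B.carrier) :
    g.left a (compRight f g r b) = compRight f g (g.left a r) b :=
  g.ext_right fun a' => by
    rw [right_compRight, g.bimod, g.bimod, right_compRight]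

/-- The composite of `f`, presenting `A` as an extension of `B`, and `g`, presenting `R` as an
extension of `A`. -/
noncomputable def comp : ExtStr B R where
  left := compLeft f g
  right := compRight f g
  left_mul b b' r := g.ext_left fun a => by
    simp only [left_compLeft, f.right_mul]
  right_mul r b b' := g.ext_right fun a => by
    simp only [right_compRight, f.left_mul]
  bimod b r b' := g.ext_left fun a => by
    rw [left_compRight, left_compLeft, left_compLeft, left_compRight]
  mul_left b r r' := g.ext_left fun a => by
    rw [left_compLeft, g.mul_left, g.mul_left, left_compLeft]
  mul_right r r' b := g.ext_right fun a => by
    rw [right_compRight, g.mul_right, g.mul_right, right_compRight]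
  balanced r b r' := by
    refine g.idem_left.induction
      (q := fun r' => R.mul (compRight f g r b) r' = R.mul r (compLeft f g b r'))
      (fun a r'' => ?_) (fun x y hx hy => ?_) r'
    · rw [compLeft_left, ← g.balanced, ← g.balanced, right_compRight]
    · rw [map_add, map_add, map_add, hx, hy]
  idem_left := isIdem_of_mem g.idem_left fun a r => by
    refine f.idem_left.induction (q := fun a => g.left a r ∈ Submodule.span k _)
      (fun b a => ?_) (fun x y hx hy => ?_) a
    · exact Submodule.subset_span ⟨b, g.left a r, compLeft_left f g b a r⟩
    · rw [map_add]; exact Submodule.add_mem _ hx hy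
  idem_right := isIdem_of_mem g.idem_right fun r a => by
    refine f.idem_right.induction (q := fun a => g.right r a ∈ Submodule.span k _)
      (fun a b => ?_) (fun x y hx hy => ?_) a
    · exact Submodule.subset_span ⟨g.right r a, b, compRight_right f g r a b⟩
    · rw [map_add]; exact Submodule.add_mem _ hx hy
  nondeg_left r hr := g.nondeg_left r fun a =>
    f.idem_right.induction (q := fun a => g.left a r = 0)
      (fun a b => by rw [← left_compLeft, hr, map_zero])
      (fun x y hx hy => by rw [map_add, LinearMap.add_apply, hx, hy, add_zero]) a
  nondeg_right r hr := g.nondeg_right r fun a =>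
    f.idem_left.induction (q := fun a => g.right r a = 0)
      (fun b a => by rw [← right_compRight, hr, map_zero, LinearMap.zero_apply])
      (fun x y hx hy => by rw [map_add, hx, hy, add_zero]) a

end Comp

/-- Over a non-degenerate algebra, an extension structure is determined by its left action. -/
theorem eq_of_left {B : NUAlg k} {A : NdI k} {f g : ExtStr B A.alg}
    (h : ∀ b a, f.left b a = g.left b a) : f = g := by
  refine ExtStr.ext (LinearMap.ext₂ h) (LinearMap.ext₂ fun a b => ?_)
  refine sub_eq_zero.1 (A.nondeg_right _ fun a' => ?_)
  rw [map_sub, LinearMap.sub_apply, f.balanced, g.balanced, h, sub_self]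

/-- The composite is characterized by its left action. -/
theorem eq_comp {B A : NUAlg k} {R : NdI k} {f : ExtStr B A} {g : ExtStr A R.alg}
    {h : ExtStr B R.alg} (H : ∀ b a r, h.left b (g.left a r) = g.left (f.left b a) r) :
    comp f g = h := by
  refine eq_of_left fun b r => ?_
  refine g.idem_left.induction (q := fun r => (comp f g).left b r = h.left b r)
    (fun a r => ?_) (fun x y hx hy => ?_) r
  · rw [H]; exact compLeft_left f g b a r
  · rw [map_add, map_add, hx, hy]

theorem comp_left {B A R : NUAlg k} (f : ExtStr B A) (g : ExtStr A R) (b : B.carrier)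
    (a : A.carrier) (r : R.carrier) :
    (comp f g).left b (g.left a r) = g.left (f.left b a) r :=
  compLeft_left f g b a r

end ExtStr

/-- Morphisms `B ⟶ A` are the non-degenerate idempotent `B`-extension structures on `A`. -/
noncomputable instance : Category (NdI k) where
  Hom B A := ExtStr B.alg A.alg
  id A := ExtStr.refl A
  comp f g := ExtStr.comp f g
  id_comp {A R} g := ExtStr.eq_comp fun b a r => (g.left_mul b a r).symm
  comp_id {B A} f := ExtStr.eq_comp fun b a r => f.mul_left b a r
  assoc {C B A R} f g h := by
    refine ExtStr.eq_comp fun c a r => ?_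
    refine g.idem_left.induction (q := fun a => (ExtStr.comp f (ExtStr.comp g h)).left c
      (h.left a r) = h.left ((ExtStr.comp f g).left c a) r) (fun b a => ?_) (fun x y hx hy => ?_) a
    · rw [← ExtStr.comp_left g h, ExtStr.comp_left, ExtStr.comp_left, ExtStr.comp_left]
    · simp only [map_add, LinearMap.add_apply, hx, hy]

namespace ExtStr

/-- A multiplicative linear bijection, as an extension. -/
def ofEquiv {B A : NdI k} (e : B.alg.carrier ≃ₗ[k] A.alg.carrier)
    (he : ∀ x y, e (B.alg.mul x y) = A.alg.mul (e x) (e y)) : B ⟶ A :=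
  { left := A.alg.mul ∘ₗ e.toLinearMap
    right := A.alg.mul.compl₂ e.toLinearMap
    left_mul := fun b b' a => by simp [he, A.alg.mul_assoc]
    right_mul := fun a b b' => by simp [he, A.alg.mul_assoc]
    bimod := fun b a b' => by simp [A.alg.mul_assoc]
    mul_left := fun b a a' => by simp [A.alg.mul_assoc]
    mul_right := fun b a a' => by simp [A.alg.mul_assoc]
    balanced := fun b a a' => by simp [A.alg.mul_assoc]
    idem_left := isIdem_of_mem A.idem fun x y =>
      Submodule.subset_span ⟨e.symm x, y, by simp⟩
    idem_right := isIdem_of_mem A.idem fun x y =>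
      Submodule.subset_span ⟨x, e.symm y, by simp⟩
    nondeg_left := fun a ha => A.nondeg_left a fun x => by simpa using ha (e.symm x)
    nondeg_right := fun a ha => A.nondeg_right a fun x => by simpa using ha (e.symm x) }

theorem ofEquiv_left {B A : NdI k} (e : B.alg.carrier ≃ₗ[k] A.alg.carrier)
    (he : ∀ x y, e (B.alg.mul x y) = A.alg.mul (e x) (e y)) (b : B.alg.carrier)
    (a : A.alg.carrier) : (ofEquiv e he).left b a = A.alg.mul (e b) a := rfl

theorem hom_ext {B A : NdI k} {f g : B ⟶ A}
    (h : ∀ b a, ExtStr.left f b a = ExtStr.left g b a) : f = g := eq_of_left h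

theorem eq_comp_hom {B A R : NdI k} {f : B ⟶ A} {g : A ⟶ R} {h : B ⟶ R}
    (H : ∀ b a r, ExtStr.left h b (ExtStr.left g a r) = ExtStr.left g (ExtStr.left f b a) r) :
    f ≫ g = h := eq_comp H

theorem ofEquiv_comp_left {B A R : NdI k} (e : B.alg.carrier ≃ₗ[k] A.alg.carrier)
    (he : ∀ x y, e (B.alg.mul x y) = A.alg.mul (e x) (e y)) (g : A ⟶ R) (b : B.alg.carrier)
    (r : R.alg.carrier) :
    ExtStr.left (ofEquiv e he ≫ g) b r = ExtStr.left g (e b) r := by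
  refine (ExtStr.idem_left g).induction
    (q := fun r => ExtStr.left (ofEquiv e he ≫ g) b r = ExtStr.left g (e b) r)
    (fun a r => ?_) (fun x y hx hy => by rw [map_add, map_add, hx, hy]) r
  refine (comp_left (ofEquiv e he) g b a r).trans ?_
  rw [ofEquiv_left, ExtStr.left_mul]

theorem natural {B B' A A' : NdI k} (e : B.alg.carrier ≃ₗ[k] B'.alg.carrier)
    (he : ∀ x y, e (B.alg.mul x y) = B'.alg.mul (e x) (e y))
    (e' : A.alg.carrier ≃ₗ[k] A'.alg.carrier)
    (he' : ∀ x y, e' (A.alg.mul x y) = A'.alg.mul (e' x) (e' y)) (f : B ⟶ A) (f' : B' ⟶ A')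
    (H : ∀ b a, e' (ExtStr.left f b a) = ExtStr.left f' (e b) (e' a)) :
    f ≫ ofEquiv e' he' = ofEquiv e he ≫ f' := by
  refine eq_comp_hom fun b a r => ?_
  rw [ofEquiv_comp_left, ofEquiv_left, ofEquiv_left, ExtStr.mul_left, H]

/-- The left action of `B` through `f` is left multiplication by the images under `e`. -/
def IsOf {B A : NdI k} (f : B ⟶ A) (e : B.alg.carrier →ₗ[k] A.alg.carrier) : Prop :=
  ∀ b a, ExtStr.left f b a = A.alg.mul (e b) a

theorem IsOf.eq {B A : NdI k} {f g : B ⟶ A} {e e' : B.alg.carrier →ₗ[k] A.alg.carrier}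
    (hf : IsOf f e) (hg : IsOf g e') (h : e = e') : f = g :=
  hom_ext fun b a => by rw [hf, hg, h]

theorem IsOf.comp {B A R : NdI k} {f : B ⟶ A} {g : A ⟶ R}
    {e : B.alg.carrier →ₗ[k] A.alg.carrier} {e' : A.alg.carrier →ₗ[k] R.alg.carrier}
    (hf : IsOf f e) (hg : IsOf g e') : IsOf (f ≫ g) (e' ∘ₗ e) := fun b r => by
  refine (ExtStr.idem_left g).induction
    (q := fun r => ExtStr.left (f ≫ g) b r = R.alg.mul ((e' ∘ₗ e) b) r)
    (fun a r => ?_) (fun x y hx hy => by rw [map_add, map_add, hx, hy]) r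
  refine (comp_left f g b a r).trans ?_
  rw [hf, ExtStr.left_mul, hg]; rfl

theorem isOf_id (A : NdI k) : IsOf (𝟙 A) LinearMap.id := fun _ _ => rfl

theorem isOf_ofEquiv {B A : NdI k} (e : B.alg.carrier ≃ₗ[k] A.alg.carrier)
    (he : ∀ x y, e (B.alg.mul x y) = A.alg.mul (e x) (e y)) :
    IsOf (ofEquiv e he) e.toLinearMap := fun _ _ => rfl

/-- A multiplicative linear bijection, as an isomorphism. -/
noncomputable def isoOfEquiv {A B : NdI k} (e : A.alg.carrier ≃ₗ[k] B.alg.carrier)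
    (he : ∀ x y, e (A.alg.mul x y) = B.alg.mul (e x) (e y)) : A ≅ B where
  hom := ofEquiv e he
  inv := ofEquiv e.symm fun x y => by rw [LinearEquiv.symm_apply_eq, he]; simp
  hom_inv_id := ((isOf_ofEquiv _ _).comp (isOf_ofEquiv _ _)).eq (isOf_id A) (by ext; simp)
  inv_hom_id := ((isOf_ofEquiv _ _).comp (isOf_ofEquiv _ _)).eq (isOf_id B) (by ext; simp)

end ExtStr

namespace NdI

/-- The tensor product of algebras. -/
@[reducible] noncomputable def tensor (A B : NdI k) : NdI k where
  alg := A.alg.tensor B.alg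
  projective := inferInstanceAs (Module.Projective k (A.alg.carrier ⊗[k] B.alg.carrier))
  idem := A.idem.map₂ B.idem
  nondeg_left := NondegSnd.map₂ A.nondeg_left B.nondeg_left
  nondeg_right := NondegFst.map₂ A.nondeg_right B.nondeg_right

/-- The base ring. -/
@[reducible] def base (k : Type u) [CommRing k] : NdI k where
  alg := NUAlg.base k
  projective := inferInstanceAs (Module.Projective k k)
  idem := eq_top_iff.2 fun x _ => Submodule.subset_span ⟨(1 : k), x, one_mul (M := k) x⟩
  nondeg_left x hx := (one_mul (M := k) x).symm.trans (hx (1 : k))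
  nondeg_right x hx := (mul_one (M := k) x).symm.trans (hx (1 : k))

/-- The tensor product of extensions: `(b ⊗ b') · (a ⊗ a') = (b · a) ⊗ (b' · a')`, and similarly
on the right. -/
noncomputable def tensorHom {B A B' A' : NdI k} (f : ExtStr B.alg A.alg)
    (g : ExtStr B'.alg A'.alg) : ExtStr (B.tensor B').alg (A.tensor A').alg where
  left := TensorProduct.map₂ f.left g.left
  right := TensorProduct.map₂ f.right g.right
  left_mul := map₂_assoc f.left_mul g.left_mul
  right_mul a b b' := (map₂_assoc (fun a b b' => (f.right_mul a b b').symm)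
    (fun a b b' => (g.right_mul a b b').symm) a b b').symm
  bimod := map₂_assoc f.bimod g.bimod
  mul_left b a a' := (map₂_assoc (fun b a a' => (f.mul_left b a a').symm)
    (fun b a a' => (g.mul_left b a a').symm) b a a').symm
  mul_right := map₂_assoc f.mul_right g.mul_right
  balanced := map₂_assoc f.balanced g.balanced
  idem_left := f.idem_left.map₂ g.idem_left
  idem_right := f.idem_right.map₂ g.idem_right
  nondeg_left := NondegSnd.map₂ f.nondeg_left g.nondeg_left
  nondeg_right := NondegFst.map₂ f.nondeg_right g.nondeg_right

noncomputable instance : MonoidalCategoryStruct (NdI k) where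
  tensorObj := tensor
  tensorUnit := base k
  tensorHom f g := tensorHom f g
  whiskerLeft A _ _ g := tensorHom (ExtStr.refl A) g
  whiskerRight f B := tensorHom f (ExtStr.refl B)
  associator A B C := ExtStr.isoOfEquiv
    (TensorProduct.assoc k A.alg.carrier B.alg.carrier C.alg.carrier)
    (assoc_map₂ A.alg.mul B.alg.mul C.alg.mul)
  leftUnitor A := ExtStr.isoOfEquiv (TensorProduct.lid k A.alg.carrier) (lid_map₂ A.alg.mul)
  rightUnitor A := ExtStr.isoOfEquiv (TensorProduct.rid k A.alg.carrier) (rid_map₂ A.alg.mul)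

theorem isOf_tensorHom {A B A' B' : NdI k} {f : A ⟶ B} {f' : A' ⟶ B'}
    {e : A.alg.carrier →ₗ[k] B.alg.carrier} {e' : A'.alg.carrier →ₗ[k] B'.alg.carrier}
    (hf : ExtStr.IsOf f e) (hf' : ExtStr.IsOf f' e') :
    ExtStr.IsOf (f ⊗ₘ f') (TensorProduct.map e e') := by
  intro x y
  refine LinearMap.congr_fun (LinearMap.congr_fun (f := TensorProduct.map₂
    (ExtStr.left f) (ExtStr.left f'))
    (g := TensorProduct.map₂ B.alg.mul B'.alg.mul ∘ₗ TensorProduct.map e e') ?_ x) y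
  refine TensorProduct.ext' fun a a' => TensorProduct.ext' fun b b' => ?_
  simp [hf a b, hf' a' b']

theorem isOf_associator (A B C : NdI k) : ExtStr.IsOf (α_ A B C).hom
    (TensorProduct.assoc k A.alg.carrier B.alg.carrier C.alg.carrier).toLinearMap :=
  fun _ _ => rfl

theorem isOf_leftUnitor (A : NdI k) : ExtStr.IsOf (λ_ A).hom
    (TensorProduct.lid k A.alg.carrier).toLinearMap := fun _ _ => rfl

theorem isOf_rightUnitor (A : NdI k) : ExtStr.IsOf (ρ_ A).hom
    (TensorProduct.rid k A.alg.carrier).toLinearMap := fun _ _ => rfl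

noncomputable instance : MonoidalCategory (NdI k) := MonoidalCategory.ofTensorHom
  (id_tensorHom_id := fun _ _ => rfl)
  (id_tensorHom := fun _ _ _ _ => rfl)
  (tensorHom_id := fun _ _ => rfl)
  (tensorHom_comp_tensorHom := fun f₁ f₂ g₁ g₂ => ExtStr.eq_comp_hom fun b a r =>
    (map₂_assoc (fun b a r => (ExtStr.comp_left f₁ g₁ b a r).symm)
      (fun b a r => (ExtStr.comp_left f₂ g₂ b a r).symm) b a r).symm)
  (associator_naturality := fun {X₁ X₂ X₃ Y₁ Y₂ Y₃} f₁ f₂ f₃ => ExtStr.natural _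
    (assoc_map₂ X₁.alg.mul X₂.alg.mul X₃.alg.mul) _
    (assoc_map₂ Y₁.alg.mul Y₂.alg.mul Y₃.alg.mul) _ _
    (assoc_map₂ (ExtStr.left f₁) (ExtStr.left f₂) (ExtStr.left f₃)))
  (leftUnitor_naturality := fun {X Y} f => ExtStr.natural _ (lid_map₂ X.alg.mul) _
    (lid_map₂ Y.alg.mul) _ _ (lid_map₂ (ExtStr.left f)))
  (rightUnitor_naturality := fun {X Y} f => ExtStr.natural _ (rid_map₂ X.alg.mul) _
    (rid_map₂ Y.alg.mul) _ _ (rid_map₂ (ExtStr.left f)))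
  (pentagon := fun W X Y Z =>
    ((isOf_tensorHom (isOf_associator W X Y) (ExtStr.isOf_id Z)).comp
      ((isOf_associator W (X ⊗ Y) Z).comp
        (isOf_tensorHom (ExtStr.isOf_id W) (isOf_associator X Y Z)))).eq
      ((isOf_associator (W ⊗ X) Y Z).comp (isOf_associator W X (Y ⊗ Z)))
      (TensorProduct.ext_fourfold fun _ _ _ _ => rfl))
  (triangle := fun X Y =>
    ((isOf_associator X (𝟙_ (NdI k)) Y).comp
      (isOf_tensorHom (ExtStr.isOf_id X) (isOf_leftUnitor Y))).eq
      (isOf_tensorHom (isOf_rightUnitor X) (ExtStr.isOf_id Y))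
      (TensorProduct.ext_threefold fun x t y => (TensorProduct.smul_tmul t x y).symm))

end NdI

/-! ### Modules and extensions -/

/-- A non-degenerate idempotent `k`-projective right `A`-module. -/
structure RMod (A : NUAlg k) where
  carrier : ModuleCat.{u} k
  act : carrier →ₗ[k] A.carrier →ₗ[k] carrier
  act_mul : ∀ m a b, act m (A.mul a b) = act (act m a) b
  projective : Module.Projective k carrier
  idem : IsIdem act
  nondeg : NondegFst act

/-- A non-degenerate idempotent `k`-projective left `A`-module. -/
structure LMod (A : NUAlg k) where
  carrier : ModuleCat.{u} k
  act : A.carrier →ₗ[k] carrier →ₗ[k] carrier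
  mul_act : ∀ a b m, act (A.mul a b) m = act a (act b m)
  projective : Module.Projective k carrier
  idem : IsIdem act
  nondeg : NondegSnd act

/-- A non-degenerate idempotent `k`-projective extension of the algebra `A`. (The extending
algebra itself is not required to be idempotent or non-degenerate.) -/
structure AExt (A : NUAlg k) where
  alg : NUAlg k
  str : ExtStr A alg
  projective : Module.Projective k alg.carrier

namespace RMod

variable {A : NUAlg k}

/-- A right `A`-linear map. -/
@[ext]
structure Hom (M N : RMod A) where
  hom : M.carrier ⟶ N.carrier
  map_act : ∀ m a, hom (M.act m a) = N.act (hom m) a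

instance : Category (RMod A) where
  Hom := Hom
  id M := ⟨𝟙 M.carrier, fun _ _ => rfl⟩
  comp f g := ⟨f.hom ≫ g.hom, fun m a => by simp [f.map_act, g.map_act]⟩

/-- The forgetful functor to `k`-modules. -/
def forget (A : NUAlg k) : RMod A ⥤ ModuleCat.{u} k where
  obj M := M.carrier
  map f := Hom.hom f

end RMod

namespace LMod

variable {A : NUAlg k}

/-- A left `A`-linear map. -/
@[ext]
structure Hom (M N : LMod A) where
  hom : M.carrier ⟶ N.carrier
  map_act : ∀ a m, hom (M.act a m) = N.act a (hom m)

instance : Category (LMod A) where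
  Hom := Hom
  id M := ⟨𝟙 M.carrier, fun _ _ => rfl⟩
  comp f g := ⟨f.hom ≫ g.hom, fun m a => by simp [f.map_act, g.map_act]⟩

/-- The forgetful functor to `k`-modules. -/
def forget (A : NUAlg k) : LMod A ⥤ ModuleCat.{u} k where
  obj M := M.carrier
  map f := Hom.hom f

end LMod

namespace AExt

variable {A : NUAlg k}

/-- A transformation of extensions: an `A`-bilinear algebra map. -/
@[ext]
structure Hom (P Q : AExt A) where
  hom : P.alg.carrier ⟶ Q.alg.carrier
  map_mul : ∀ p p', hom (P.alg.mul p p') = Q.alg.mul (hom p) (hom p')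
  map_left : ∀ a p, hom (P.str.left a p) = Q.str.left a (hom p)
  map_right : ∀ p a, hom (P.str.right p a) = Q.str.right (hom p) a

instance : Category (AExt A) where
  Hom := Hom
  id P := ⟨𝟙 P.alg.carrier, fun _ _ => rfl, fun _ _ => rfl, fun _ _ => rfl⟩
  comp f g := ⟨f.hom ≫ g.hom, fun _ _ => by simp [f.map_mul, g.map_mul],
    fun _ _ => by simp [f.map_left, g.map_left], fun _ _ => by simp [f.map_right, g.map_right]⟩

/-- The forgetful functor to left modules. -/
def toLMod (A : NUAlg k) : AExt A ⥤ LMod A where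
  obj P := ⟨P.alg.carrier, P.str.left, P.str.left_mul, P.projective, P.str.idem_left,
    P.str.nondeg_left⟩
  map f := ⟨Hom.hom f, Hom.map_left f⟩

/-- The forgetful functor to right modules. -/
def toRMod (A : NUAlg k) : AExt A ⥤ RMod A where
  obj P := ⟨P.alg.carrier, P.str.right, P.str.right_mul, P.projective, P.str.idem_right,
    P.str.nondeg_right⟩
  map f := ⟨Hom.hom f, Hom.map_right f⟩

/-- A morphism `A ⟶ B` of non-degenerate idempotent `k`-projective algebras, viewed as an
`A`-extension with underlying algebra `B`. -/
noncomputable def ofHom {A B : NdI k} (f : A ⟶ B) : AExt A.alg := ⟨B.alg, f, B.projective⟩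

/-- The canonical extension of `A` by itself. -/
noncomputable def self (A : NdI k) : AExt A.alg := ofHom (𝟙 A)

end AExt

/-! ### Strict monoidal functors and the main structure -/

/-- A functor is strict monoidal when it is monoidal with identities as structure morphisms. -/
structure IsStrictMonoidal {C D : Type*} [Category C] [MonoidalCategory C] [Category D]
    [MonoidalCategory D] (F : C ⥤ D) : Prop where
  unit_eq : 𝟙_ D = F.obj (𝟙_ C)
  tensor_eq : ∀ X Y : C, F.obj X ⊗ F.obj Y = F.obj (X ⊗ Y)
  exists_monoidal : ∃ _ : F.Monoidal, Functor.LaxMonoidal.ε F = eqToHom unit_eq ∧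
    ∀ X Y : C, Functor.LaxMonoidal.μ F X Y = eqToHom (tensor_eq X Y)

/-- Monoidal structures on the categories of left `A`-modules, right `A`-modules and
`A`-extensions for which all functors in the square of forgetful functors
`A`-extensions ⥤ left (right) `A`-modules ⥤ `k`-modules are strict monoidal, and for which the
underlying algebras of a tensor product of extensions and of the unit extension are the tensor
product algebra and the algebra `k`. -/
structure MonoidalLift (A : NUAlg k) where
  monL : MonoidalCategory (LMod A)
  monR : MonoidalCategory (RMod A)
  monE : MonoidalCategory (AExt A)
  strict_forgetL : IsStrictMonoidal (LMod.forget A)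
  strict_forgetR : IsStrictMonoidal (RMod.forget A)
  strict_toLMod : IsStrictMonoidal (AExt.toLMod A)
  strict_toRMod : IsStrictMonoidal (AExt.toRMod A)
  tensor_alg : ∀ P Q : AExt A, (P ⊗ Q).alg = P.alg.tensor Q.alg
  unit_alg : (𝟙_ (AExt A)).alg = NUAlg.base k

end MultBialg

/-! A morphism `B ⟶ A` of `NdI k` allows every `A`-module to be restricted to `B`. For `M = AM` the
action is `b · Σ aᵢmᵢ = Σ (b · aᵢ)mᵢ`; balancedness and non-degeneracy make it well defined.
Restriction respects identities, composites and external tensor products (`LMod.res_refl`,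
`LMod.res_comp`, `LMod.box_res`). So a comultiplication turns the external product of two
`A`-modules into an `A`-module, a counit makes `k` one, and by `LMod.res_map` the comonoid laws make
the usual constraints of `k`-modules `A`-linear. The left-hand form of the laws implies the
right-hand form (`ExtStr.right_comm_of_left`), so right modules are covered as well, and an
extension is an algebra with compatible left and right module structures.

Conversely, let the three monoidal structures be given. Since the underlying algebras are
prescribed, the product of the canonical extension with itself is an extension structure `Δ` on `A ⊗
A`, and the unit object is an extension structure `ε` on `k`. For `m` in `M` and `n` in `N`, the
orbit maps `a ↦ am` and `a ↦ an` are `A`-linear, hence so is their tensor product, which strictness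
identifies with the ordinary tensor product of linear maps. As the elements `bm ⊗ cn` span `M ⊗ N`,
the action on `M ⊗ N` is forced to be the one defined by `Δ` (`LMod.tensorObj_eq`). Strictness also
forces the constraints to be the usual ones, and their linearity on regular modules is the comonoid
laws (`LMod.comonObj`). Finally, a monoidal structure for which a faithful functor is strict is
determined by its objects (`IsStrictMonoidal.monoidalCategory_eq`), so the given structures are
those built from `Δ` and `ε`. -/

namespace MultBialg

variable {k : Type u} [CommRing k]

/-! ### Strict monoidal functors and uniqueness of lifted monoidal structures -/

namespace IsStrictMonoidal

section

variable {C D : Type*} [Category C] [MonoidalCategory C] [Category D] [MonoidalCategory D]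
  {F : C ⥤ D}

/-- Naturality of `μ`, with `μ` an `eqToHom`. Here and in the next lemmas the point is that the
right-hand side involves the monoidal structure of the source only through its objects. -/
theorem map_whiskerLeft (h : IsStrictMonoidal F) (X : C) {Y Z : C} (f : Y ⟶ Z) :
    F.map (X ◁ f) = eqToHom (h.tensor_eq X Y).symm ≫ F.obj X ◁ F.map f ≫
      eqToHom (h.tensor_eq X Z) := by
  obtain ⟨_, -, hμ⟩ := h.exists_monoidal
  rw [← hμ, ← cancel_epi (eqToHom (h.tensor_eq X Y)), ← hμ, Functor.LaxMonoidal.μ_natural_right,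
    hμ, eqToHom_trans_assoc, eqToHom_refl, Category.id_comp]

theorem map_whiskerRight (h : IsStrictMonoidal F) {X Y : C} (f : X ⟶ Y) (Z : C) :
    F.map (f ▷ Z) = eqToHom (h.tensor_eq X Z).symm ≫ F.map f ▷ F.obj Z ≫
      eqToHom (h.tensor_eq Y Z) := by
  obtain ⟨_, -, hμ⟩ := h.exists_monoidal
  rw [← hμ, ← cancel_epi (eqToHom (h.tensor_eq X Z)), ← hμ, Functor.LaxMonoidal.μ_natural_left,
    hμ, eqToHom_trans_assoc, eqToHom_refl, Category.id_comp]

theorem map_tensorHom (h : IsStrictMonoidal F) {X Y X' Y' : C} (f : X ⟶ Y) (g : X' ⟶ Y') :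
    F.map (f ⊗ₘ g) = eqToHom (h.tensor_eq X X').symm ≫ (F.map f ⊗ₘ F.map g) ≫
      eqToHom (h.tensor_eq Y Y') := by
  rw [MonoidalCategory.tensorHom_def, Functor.map_comp, h.map_whiskerRight, h.map_whiskerLeft,
    MonoidalCategory.tensorHom_def]
  simp

theorem map_associator (h : IsStrictMonoidal F) (X Y Z : C) :
    F.map (α_ X Y Z).hom = eqToHom (h.tensor_eq (X ⊗ Y) Z).symm ≫
      eqToHom (h.tensor_eq X Y).symm ▷ F.obj Z ≫ (α_ (F.obj X) (F.obj Y) (F.obj Z)).hom ≫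
      F.obj X ◁ eqToHom (h.tensor_eq Y Z) ≫ eqToHom (h.tensor_eq X (Y ⊗ Z)) := by
  obtain ⟨_, -, hμ⟩ := h.exists_monoidal
  have := Functor.LaxMonoidal.associativity F X Y Z
  simp only [hμ] at this
  rw [← this]
  simp

theorem map_leftUnitor (h : IsStrictMonoidal F) (X : C) :
    F.map (λ_ X).hom = eqToHom (h.tensor_eq (𝟙_ C) X).symm ≫ eqToHom h.unit_eq.symm ▷ F.obj X ≫
      (λ_ (F.obj X)).hom := by
  obtain ⟨_, hε, hμ⟩ := h.exists_monoidal
  rw [Functor.LaxMonoidal.left_unitality, hε, hμ]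
  simp

theorem map_rightUnitor (h : IsStrictMonoidal F) (X : C) :
    F.map (ρ_ X).hom = eqToHom (h.tensor_eq X (𝟙_ C)).symm ≫ F.obj X ◁ eqToHom h.unit_eq.symm ≫
      (ρ_ (F.obj X)).hom := by
  obtain ⟨_, hε, hμ⟩ := h.exists_monoidal
  rw [Functor.LaxMonoidal.right_unitality, hε, hμ]
  simp

end

/-- A faithful functor induces a monoidal structure along which it is strict monoidal, provided
that the operations are already strictly preserved. -/
theorem of_induced {C D : Type*} [Category C] [MonoidalCategoryStruct C] [Category D]
    [MonoidalCategory D] (F : C ⥤ D) [F.Faithful] (d : Monoidal.InducingFunctorData F)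
    (hunit : 𝟙_ D = F.obj (𝟙_ C)) (hobj : ∀ X Y : C, F.obj X ⊗ F.obj Y = F.obj (X ⊗ Y))
    (hε : d.εIso.hom = eqToHom hunit) (hμ : ∀ X Y, (d.μIso X Y).hom = eqToHom (hobj X Y)) :
    letI := Monoidal.induced F d
    IsStrictMonoidal F :=
  letI := Monoidal.induced F d
  { unit_eq := hunit
    tensor_eq := hobj
    exists_monoidal := ⟨Monoidal.fromInducedMonoidal F d, hε, hμ⟩ }

/-- A monoidal structure for which a given faithful functor is strict monoidal is determined by
its effect on objects. -/
theorem monoidalCategory_eq {C D : Type*} [Category C] [Category D] [MonoidalCategory D]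
    (F : C ⥤ D) [F.Faithful] (m₁ m₂ : MonoidalCategory C)
    (h₁ : letI := m₁; IsStrictMonoidal F) (h₂ : letI := m₂; IsStrictMonoidal F)
    (hobj : ∀ X Y, m₁.tensorObj X Y = m₂.tensorObj X Y)
    (hunit : m₁.tensorUnit = m₂.tensorUnit) : m₁ = m₂ := by
  -- An equation between functions can be substituted once both structures are taken apart; the
  -- formulas for the images under `F` are recorded beforehand.
  replace hobj : m₁.tensorObj = m₂.tensorObj := funext fun X => funext fun Y => hobj X Y
  have a₁ := @map_whiskerLeft _ _ _ m₁ _ _ _ h₁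
  have a₂ := @map_whiskerLeft _ _ _ m₂ _ _ _ h₂
  have b₁ := @map_whiskerRight _ _ _ m₁ _ _ _ h₁
  have b₂ := @map_whiskerRight _ _ _ m₂ _ _ _ h₂
  have c₁ := @map_tensorHom _ _ _ m₁ _ _ _ h₁
  have c₂ := @map_tensorHom _ _ _ m₂ _ _ _ h₂
  have d₁ := @map_associator _ _ _ m₁ _ _ _ h₁
  have d₂ := @map_associator _ _ _ m₂ _ _ _ h₂
  have e₁ := @map_leftUnitor _ _ _ m₁ _ _ _ h₁
  have e₂ := @map_leftUnitor _ _ _ m₂ _ _ _ h₂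
  have f₁ := @map_rightUnitor _ _ _ m₁ _ _ _ h₁
  have f₂ := @map_rightUnitor _ _ _ m₂ _ _ _ h₂
  obtain @⟨s₁⟩ := m₁
  obtain @⟨s₂⟩ := m₂
  obtain ⟨o₁, wl₁, wr₁, t₁, un₁, al₁, lu₁, ru₁⟩ := s₁
  obtain ⟨o₂, wl₂, wr₂, t₂, un₂, al₂, lu₂, ru₂⟩ := s₂
  subst hobj hunit
  -- With equal objects, the two formulas for the image under `F` have the same right-hand side, and
  -- faithfulness concludes; likewise for the other operations.
  obtain rfl : @wl₁ = @wl₂ := by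
    funext X Y Z f
    exact F.map_injective ((a₁ X f).trans (a₂ X f).symm)
  obtain rfl : @wr₁ = @wr₂ := by
    funext X Y f Z
    exact F.map_injective ((b₁ f Z).trans (b₂ f Z).symm)
  obtain rfl : @t₁ = @t₂ := by
    funext X Y X' Y' f g
    exact F.map_injective ((c₁ f g).trans (c₂ f g).symm)
  obtain rfl : al₁ = al₂ := by
    funext X Y Z
    exact Iso.ext (F.map_injective ((d₁ X Y Z).trans (d₂ X Y Z).symm))
  obtain rfl : lu₁ = lu₂ := by
    funext X
    exact Iso.ext (F.map_injective ((e₁ X).trans (e₂ X).symm))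
  obtain rfl : ru₁ = ru₂ := by
    funext X
    exact Iso.ext (F.map_injective ((f₁ X).trans (f₂ X).symm))
  rfl

end IsStrictMonoidal

-- Extension structures and algebra isomorphisms

attribute [instance] LMod.projective RMod.projective AExt.projective

namespace ExtStr

/-- The external tensor product of extensions of two algebras. -/
@[reducible] noncomputable def tensor {B A B' A' : NUAlg k} [Module.Projective k A.carrier]
    [Module.Projective k A'.carrier] (f : ExtStr B A) (g : ExtStr B' A') :
    ExtStr (B.tensor B') (A.tensor A') where
  left := TensorProduct.map₂ f.left g.left
  right := TensorProduct.map₂ f.right g.right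
  left_mul := map₂_assoc f.left_mul g.left_mul
  right_mul a b b' := (map₂_assoc (fun a b b' => (f.right_mul a b b').symm)
    (fun a b b' => (g.right_mul a b b').symm) a b b').symm
  bimod := map₂_assoc f.bimod g.bimod
  mul_left b a a' := (map₂_assoc (fun b a a' => (f.mul_left b a a').symm)
    (fun b a a' => (g.mul_left b a a').symm) b a a').symm
  mul_right := map₂_assoc f.mul_right g.mul_right
  balanced := map₂_assoc f.balanced g.balanced
  idem_left := f.idem_left.map₂ g.idem_left
  idem_right := f.idem_right.map₂ g.idem_right
  nondeg_left := NondegSnd.map₂ f.nondeg_left g.nondeg_left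
  nondeg_right := NondegFst.map₂ f.nondeg_right g.nondeg_right

/-- Composing with a multiplicative linear bijection, in terms of the left action. -/
theorem comp_ofEquiv_eq_iff {B A R : NdI k} (e : A.alg.carrier ≃ₗ[k] R.alg.carrier)
    (he : ∀ x y, e (A.alg.mul x y) = R.alg.mul (e x) (e y)) (f : B ⟶ A) (g : B ⟶ R) :
    f ≫ ofEquiv e he = g ↔
      ∀ b a, e (ExtStr.left f b a) = ExtStr.left g b (e a) := by
  constructor
  · rintro rfl b a
    refine sub_eq_zero.1 (R.nondeg_right _ fun r => ?_)
    rw [map_sub, LinearMap.sub_apply, ← ExtStr.mul_left, ← ofEquiv_left e he, ← ofEquiv_left e he]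
    exact sub_eq_zero.2 (comp_left f (ofEquiv e he) b a r).symm
  · intro h
    refine eq_comp_hom fun b a r => ?_
    rw [ofEquiv_left, ofEquiv_left, h, ExtStr.mul_left]

/-- By non-degeneracy it suffices to multiply on the right by some `e r`. Balancedness then moves
`b` to the left of `r`, where the hypothesis applies. -/
theorem right_comm_of_left {B A R : NdI k} (e : A.alg.carrier ≃ₗ[k] R.alg.carrier)
    (he : ∀ x y, e (A.alg.mul x y) = R.alg.mul (e x) (e y)) (f : B ⟶ A) (g : B ⟶ R)
    (h : ∀ b a, e (ExtStr.left f b a) = ExtStr.left g b (e a)) (a : A.alg.carrier)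
    (b : B.alg.carrier) : e (ExtStr.right f a b) = ExtStr.right g (e a) b := by
  refine sub_eq_zero.1 (R.nondeg_right _ fun r => ?_)
  obtain ⟨r, rfl⟩ := e.surjective r
  rw [map_sub, LinearMap.sub_apply, ExtStr.balanced, ← h, ← he, ← he, ExtStr.balanced, sub_self]

end ExtStr

/-! ### Left modules: restriction along an extension structure, external tensor product -/

namespace LMod

section Res

variable {B A : NUAlg k} (f : ExtStr B A) (M : LMod A)

theorem act_injective {x y : M.carrier} (h : ∀ a, M.act a x = M.act a y) : x = y :=
  sub_eq_zero.1 (M.nondeg _ fun a => by rw [map_sub, h, sub_self])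

/-- For `m = Σ aᵢmᵢ` the element is `Σ (b · aᵢ)mᵢ`, verified by balancedness. The condition on `s`
does not mention the decomposition of `m` and determines `s` by non-degeneracy, so the action
defined from it is automatically well defined and bilinear. -/
theorem exists_act (b : B.carrier) (m : M.carrier) :
    ∃ s, ∀ a, M.act a s = M.act (f.right a b) m := by
  refine M.idem.induction (q := fun m => ∃ s, ∀ a, M.act a s = M.act (f.right a b) m)
    (fun a' m' => ⟨M.act (f.left b a') m', fun a => ?_⟩) ?_ m
  · rw [← M.mul_act, ← M.mul_act, f.balanced]
  · rintro x y ⟨s, hs⟩ ⟨t, ht⟩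
    exact ⟨s + t, fun a => by rw [map_add, map_add, hs, ht]⟩

/-- The `B`-action on an `A`-module obtained from a `B`-extension structure on `A`. -/
noncomputable def resAct : B.carrier →ₗ[k] M.carrier →ₗ[k] M.carrier :=
  LinearMap.mk₂ k (fun b m => (exists_act f M b m).choose)
    (fun b b' m => M.act_injective fun a => by
      rw [map_add, (exists_act f M _ m).choose_spec, (exists_act f M _ m).choose_spec,
        (exists_act f M _ m).choose_spec]; simp)
    (fun t b m => M.act_injective fun a => by
      rw [map_smul, (exists_act f M _ m).choose_spec, (exists_act f M _ m).choose_spec]; simp)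
    (fun b m m' => M.act_injective fun a => by
      rw [map_add, (exists_act f M b _).choose_spec, (exists_act f M b _).choose_spec,
        (exists_act f M b _).choose_spec]; simp)
    (fun t b m => M.act_injective fun a => by
      rw [map_smul, (exists_act f M b _).choose_spec, (exists_act f M b _).choose_spec]; simp)

theorem act_resAct (a : A.carrier) (b : B.carrier) (m : M.carrier) :
    M.act a (resAct f M b m) = M.act (f.right a b) m :=
  (exists_act f M b m).choose_spec a

theorem resAct_act (b : B.carrier) (a : A.carrier) (m : M.carrier) :
    resAct f M b (M.act a m) = M.act (f.left b a) m :=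
  M.act_injective fun a' => by
    rw [act_resAct, ← M.mul_act, ← M.mul_act, f.balanced]

/-- Restriction of a module along a `B`-extension structure on `A`. -/
@[reducible] noncomputable def res : LMod B where
  carrier := M.carrier
  act := resAct f M
  mul_act b b' m := M.act_injective fun a => by simp only [act_resAct, f.right_mul]
  projective := M.projective
  idem := isIdem_of_mem M.idem fun a m => by
    refine f.idem_left.induction (q := fun a => M.act a m ∈ Submodule.span k _)
      (fun b a => ?_) (fun x y hx hy => ?_) a
    · exact Submodule.subset_span ⟨b, M.act a m, resAct_act f M b a m⟩
    · rw [map_add]; exact Submodule.add_mem _ hx hy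
  nondeg m hm := M.nondeg m fun a =>
    f.idem_right.induction (q := fun a => M.act a m = 0)
      (fun a b => by rw [← act_resAct, hm, map_zero])
      (fun x y hx hy => by rw [map_add, LinearMap.add_apply, hx, hy, add_zero]) a

theorem res_act (b : B.carrier) (a : A.carrier) (m : M.carrier) :
    (res f M).act b (M.act a m) = M.act (f.left b a) m := resAct_act f M b a m

end Res

/-- By idempotency only elements `bm` matter, and on these both actions are known. This gives the
`A`-linearity of tensor products of maps (`e` the identity) and of the constraints (`e` the
constraint on algebras). -/
theorem res_map {A B C : NUAlg k} {f : ExtStr A B} {g : ExtStr A C} {M : LMod B} {N : LMod C}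
    (e : B.carrier →ₗ[k] C.carrier) (u : M.carrier →ₗ[k] N.carrier)
    (hu : ∀ b m, u (M.act b m) = N.act (e b) (u m))
    (he : ∀ a b, e (f.left a b) = g.left a (e b)) (a : A.carrier) (m : M.carrier) :
    u ((res f M).act a m) = (res g N).act a (u m) := by
  refine M.idem.induction (q := fun m => u ((res f M).act a m) = (res g N).act a (u m))
    (fun b m => ?_) (fun x y hx hy => ?_) m
  · rw [res_act, hu, hu, res_act, he]
  · simp only [map_add, hx, hy]

/-- The external tensor product of modules over two algebras. -/
@[reducible] noncomputable def box {A A' : NUAlg k} (M : LMod A) (N : LMod A') : LMod (A.tensor A') where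
  carrier := ModuleCat.of k (M.carrier ⊗[k] N.carrier)
  act := TensorProduct.map₂ M.act N.act
  mul_act := map₂_assoc M.mul_act N.mul_act
  projective := inferInstanceAs (Module.Projective k (M.carrier ⊗[k] N.carrier))
  idem := M.idem.map₂ N.idem
  nondeg := NondegSnd.map₂ M.nondeg N.nondeg

theorem map_box {A A' : NUAlg k} {M M' : LMod A} {N N' : LMod A'} (f : M ⟶ M') (g : N ⟶ N')
    (x : A.carrier ⊗[k] A'.carrier) (t : M.carrier ⊗[k] N.carrier) :
    TensorProduct.map f.hom.hom g.hom.hom ((box M N).act x t) =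
      (box M' N').act x (TensorProduct.map f.hom.hom g.hom.hom t) := by
  refine LinearMap.congr_fun (LinearMap.congr_fun
    (f := (TensorProduct.map₂ M.act N.act).compr₂ (TensorProduct.map f.hom.hom g.hom.hom))
    (g := (TensorProduct.map₂ M'.act N'.act).compl₂ (TensorProduct.map f.hom.hom g.hom.hom))
    ?_ x) t
  refine TensorProduct.ext' fun a a' => TensorProduct.ext' fun m n => ?_
  simpa using congrArg₂ (· ⊗ₜ[k] ·) (f.map_act a m) (g.map_act a' n)

theorem res_comp_act {C B A : NUAlg k} (f : ExtStr C B) (g : ExtStr B A) (M : LMod A)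
    (c : C.carrier) (m : M.carrier) :
    (res (f.comp g) M).act c m = (res f (res g M)).act c m := by
  refine M.idem.induction (q := fun m => (res (f.comp g) M).act c m = (res f (res g M)).act c m)
    (fun a m => ?_) (fun x y hx hy => ?_) m
  -- A second reduction, to scalars `g.left b a`: both sides then become the action of `g.left
  -- (f.left c b) a` on `m`.
  · refine g.idem_left.induction (q := fun a => (res (f.comp g) M).act c (M.act a m) =
      (res f (res g M)).act c (M.act a m)) (fun b a => ?_) (fun x y hx hy => ?_) a
    · rw [res_act, ExtStr.comp_left, ← res_act g, ← res_act g]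
      exact (res_act f (res g M) c b _).symm
    · simp only [map_add, LinearMap.add_apply, hx, hy]
  · simp only [map_add, hx, hy]

theorem res_refl_act {A : NdI k} (M : LMod A.alg) (a : A.alg.carrier) (m : M.carrier) :
    (res (ExtStr.refl A) M).act a m = M.act a m := by
  refine M.idem.induction (q := fun m => (res (ExtStr.refl A) M).act a m = M.act a m)
    (fun b m => ?_) (fun x y hx hy => ?_) m
  · rw [res_act, ← M.mul_act]; rfl
  · simp only [map_add, hx, hy]

theorem box_res_act {B B' : NUAlg k} {A A' : NdI k} (f : ExtStr B A.alg) (g : ExtStr B' A'.alg)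
    (M : LMod A.alg) (N : LMod A'.alg) (x : B.carrier ⊗[k] B'.carrier)
    (t : M.carrier ⊗[k] N.carrier) :
    (box (res f M) (res g N)).act x t = (res (f.tensor g) (box M N)).act x t := by
  refine (box M N).idem.induction (q := fun t => (box (res f M) (res g N)).act x t =
    (res (f.tensor g) (box M N)).act x t) (fun y t => ?_) (fun x y hx hy => ?_) t
  · rw [res_act]
    exact (map₂_assoc (fun b a m => (res_act f M b a m).symm)
      (fun b a m => (res_act g N b a m).symm) x y t).symm
  · simp only [map_add, hx, hy]

/-- The carriers need only be propositionally equal, which is what strictness of the forgetful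
functor supplies. -/
theorem ext_act {A : NUAlg k} {M N : LMod A} (h : M.carrier = N.carrier)
    (H : ∀ a x, eqToHom h (M.act a x) = N.act a (eqToHom h x)) : M = N := by
  obtain ⟨M, actM, _, _, _, _⟩ := M
  obtain ⟨N, actN, _, _, _, _⟩ := N
  dsimp only at h
  subst h
  obtain rfl : actM = actN := LinearMap.ext₂ H
  rfl

/-- A bijective linear map compatible with the actions is an isomorphism of modules. -/
def isoMk {A : NUAlg k} {M N : LMod A} (e : M.carrier ≃ₗ[k] N.carrier)
    (h : ∀ a m, e (M.act a m) = N.act a (e m)) : M ≅ N where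
  hom := ⟨ModuleCat.ofHom e.toLinearMap, fun m a => h m a⟩
  inv := ⟨ModuleCat.ofHom e.symm.toLinearMap, fun a n =>
    e.injective ((e.apply_symm_apply _).trans (by
      rw [h]; exact congrArg _ (e.apply_symm_apply n).symm))⟩
  hom_inv_id := Hom.ext (ModuleCat.hom_ext (LinearMap.ext e.symm_apply_apply))
  inv_hom_id := Hom.ext (ModuleCat.hom_ext (LinearMap.ext e.apply_symm_apply))

instance (A : NUAlg k) : (forget A).Faithful where
  map_injective h := Hom.ext h

section Tensor

variable {A : NUAlg k} (Δ : ExtStr A (A.tensor A)) (ε : ExtStr A (NUAlg.base k))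

/-- The tensor product of modules defined by an extension structure on `A ⊗ A`. -/
@[reducible] noncomputable def tensor (M N : LMod A) : LMod A := res Δ (box M N)

/-- The module `k` defined by an extension structure on `k`. -/
@[reducible] def unit : LMod A where
  carrier := ModuleCat.of k k
  act := ε.left
  mul_act := ε.left_mul
  projective := inferInstanceAs (Module.Projective k k)
  idem := ε.idem_left
  nondeg := ε.nondeg_left

/-- The tensor product of morphisms of modules. -/
noncomputable def tensorMap {M M' N N' : LMod A} (f : M ⟶ M') (g : N ⟶ N') :
    tensor Δ M N ⟶ tensor Δ M' N' :=
  ⟨ModuleCat.ofHom (TensorProduct.map f.hom.hom g.hom.hom),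
    res_map (M := box M N) (N := box M' N') LinearMap.id _ (map_box f g) (fun _ _ => rfl)⟩

/-- The right-hand side is the tensor product of the orbit maps of `m` and `n`, evaluated at `a · (b
⊗ c)`; this form is matched with an arbitrary strict monoidal structure in `tensorObj_eq`. -/
theorem tensor_act_tmul (M N : LMod A) (a b c : A.carrier) (m : M.carrier) (n : N.carrier) :
    (tensor Δ M N).act a (M.act b m ⊗ₜ[k] N.act c n) =
      TensorProduct.map (M.act.flip m) (N.act.flip n) (Δ.left a (b ⊗ₜ c)) := by
  refine (res_act Δ (box M N) a (b ⊗ₜ c) (m ⊗ₜ n)).trans ?_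
  generalize Δ.left a (b ⊗ₜ c) = z
  change TensorProduct.map₂ M.act N.act z (m ⊗ₜ n) = _
  refine LinearMap.congr_fun (f := (TensorProduct.map₂ M.act N.act).flip (m ⊗ₜ n)) ?_ z
  exact TensorProduct.ext' fun a b => rfl

end Tensor

/-- The base ring as a module over itself. -/
@[reducible] def baseModule (k : Type u) [CommRing k] : LMod (NUAlg.base k) :=
  ⟨ModuleCat.of k k, LinearMap.mul k k, (NUAlg.base k).mul_assoc, (NdI.base k).projective,
    (NdI.base k).idem, (NdI.base k).nondeg_left⟩

theorem res_baseModule {A : NUAlg k} (ε : ExtStr A (NUAlg.base k)) :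
    res ε (baseModule k) = unit ε := by
  refine ext_act rfl fun a x => ?_
  have h := res_act ε (baseModule k) a x (1 : k)
  have h1 : (baseModule k).act x (1 : k) = x := mul_one (M := k) x
  have h2 : (baseModule k).act (ε.left a x) (1 : k) = ε.left a x := mul_one (M := k) _
  rw [h1, h2] at h
  exact h

theorem res_refl {A : NdI k} (M : LMod A.alg) : res (ExtStr.refl A) M = M :=
  ext_act rfl (res_refl_act M)

theorem res_comp {C B A : NUAlg k} (f : ExtStr C B) (g : ExtStr B A) (M : LMod A) :
    res (f.comp g) M = res f (res g M) :=
  ext_act rfl (res_comp_act f g M)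

theorem box_res {B B' : NUAlg k} {A A' : NdI k} (f : ExtStr B A.alg) (g : ExtStr B' A'.alg)
    (M : LMod A.alg) (N : LMod A'.alg) :
    box (res f M) (res g N) = res (f.tensor g) (box M N) :=
  ext_act rfl (box_res_act f g M N)

end LMod

/-! ### The comonoid laws in terms of left actions -/

namespace NdI

variable {A : NdI k} (Δ : A ⟶ A ⊗ A) (ε : A ⟶ 𝟙_ (NdI k))

theorem associator_hom (A B C : NdI k) : (α_ A B C).hom =
    ExtStr.ofEquiv (B := (A ⊗ B) ⊗ C) (A := A ⊗ (B ⊗ C))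
      (TensorProduct.assoc k A.alg.carrier B.alg.carrier C.alg.carrier)
      (assoc_map₂ A.alg.mul B.alg.mul C.alg.mul) := rfl

theorem leftUnitor_hom (A : NdI k) : (λ_ A).hom = ExtStr.ofEquiv (B := 𝟙_ (NdI k) ⊗ A)
    (TensorProduct.lid k A.alg.carrier) (lid_map₂ A.alg.mul) := rfl

theorem rightUnitor_hom (A : NdI k) : (ρ_ A).hom = ExtStr.ofEquiv (B := A ⊗ 𝟙_ (NdI k))
    (TensorProduct.rid k A.alg.carrier) (rid_map₂ A.alg.mul) := rfl

/-- The associator comes from a linear bijection, so composing with it amounts to transporting the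
left action. The resulting condition has the shape of the last hypothesis of `LMod.res_map`. -/
theorem coassoc_iff : Δ ≫ A ◁ Δ = Δ ≫ Δ ▷ A ≫ (α_ A A A).hom ↔
    ∀ a x, TensorProduct.assoc k A.alg.carrier A.alg.carrier A.alg.carrier
      (ExtStr.left (Δ ≫ Δ ▷ A) a x) = ExtStr.left (Δ ≫ A ◁ Δ) a
        (TensorProduct.assoc k A.alg.carrier A.alg.carrier A.alg.carrier x) := by
  rw [eq_comm, ← Category.assoc, associator_hom]
  generalize Δ ≫ Δ ▷ A = f
  generalize Δ ≫ A ◁ Δ = g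
  rw [ExtStr.comp_ofEquiv_eq_iff]

theorem left_counit_iff : Δ ≫ ε ▷ A = (λ_ A).inv ↔
    ∀ a x, TensorProduct.lid k A.alg.carrier (ExtStr.left (Δ ≫ ε ▷ A) a x) =
      ExtStr.left (𝟙 A) a (TensorProduct.lid k A.alg.carrier x) := by
  rw [← cancel_mono (λ_ A).hom, Iso.inv_hom_id, leftUnitor_hom]
  generalize Δ ≫ ε ▷ A = f
  generalize 𝟙 A = g
  rw [ExtStr.comp_ofEquiv_eq_iff]

theorem right_counit_iff : Δ ≫ A ◁ ε = (ρ_ A).inv ↔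
    ∀ a x, TensorProduct.rid k A.alg.carrier (ExtStr.left (Δ ≫ A ◁ ε) a x) =
      ExtStr.left (𝟙 A) a (TensorProduct.rid k A.alg.carrier x) := by
  rw [← cancel_mono (ρ_ A).hom, Iso.inv_hom_id, rightUnitor_hom]
  generalize Δ ≫ A ◁ ε = f
  generalize 𝟙 A = g
  rw [ExtStr.comp_ofEquiv_eq_iff]

end NdI

/-! ### The monoidal category of left modules over a multiplier bialgebra -/

namespace LMod

theorem act_eq_of_eq {A : NUAlg k} {M N : LMod A} (h : M = N) (hc : M.carrier = N.carrier)
    (a : A.carrier) (x : M.carrier) : eqToHom hc (M.act a x) = N.act a (eqToHom hc x) := by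
  subst h
  rfl

variable {A : NdI k}

section

variable (Δ : A ⟶ A ⊗ A) (ε : A ⟶ 𝟙_ (NdI k)) (M N P : LMod A.alg)

/-- Viewing `P` as its own restriction along the identity turns the iterated product into a single
restriction along a composite in `NdI k`. This and its three companions bring the comonoid laws to
bear on modules. -/
theorem tensor_tensor_left :
    tensor Δ (tensor Δ M N) P = res (Δ ≫ Δ ▷ A : _ ⟶ _) (box (box M N) P) := by
  refine Eq.trans ?_ (res_comp Δ (ExtStr.tensor Δ (ExtStr.refl A)) (box (box M N) P)).symm
  refine Eq.trans ?_ (congrArg (res Δ) (box_res (A := A.tensor A) Δ (ExtStr.refl A) (box M N) P))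
  rw [res_refl]

theorem tensor_tensor_right :
    tensor Δ M (tensor Δ N P) = res (Δ ≫ A ◁ Δ : _ ⟶ _) (box M (box N P)) := by
  refine Eq.trans ?_ (res_comp Δ (ExtStr.tensor (ExtStr.refl A) Δ) (box M (box N P))).symm
  refine Eq.trans ?_ (congrArg (res Δ) (box_res (A' := A.tensor A) (ExtStr.refl A) Δ M (box N P)))
  rw [res_refl]

theorem tensor_unit_left :
    tensor Δ (unit ε) M = res (Δ ≫ ε ▷ A : _ ⟶ _) (box (baseModule k) M) := by
  refine Eq.trans ?_ (res_comp Δ (ExtStr.tensor ε (ExtStr.refl A)) (box (baseModule k) M)).symm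
  refine Eq.trans ?_ (congrArg (res Δ) (box_res (A := NdI.base k) ε (ExtStr.refl A)
    (baseModule k) M))
  rw [res_refl, res_baseModule]

theorem tensor_unit_right :
    tensor Δ M (unit ε) = res (Δ ≫ A ◁ ε : _ ⟶ _) (box M (baseModule k)) := by
  refine Eq.trans ?_ (res_comp Δ (ExtStr.tensor (ExtStr.refl A) ε) (box M (baseModule k))).symm
  refine Eq.trans ?_ (congrArg (res Δ) (box_res (A' := NdI.base k) (ExtStr.refl A) ε M
    (baseModule k)))
  rw [res_refl, res_baseModule]

end

variable (c : ComonObj A) (M N P : LMod A.alg)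

/-- Both bracketings are restrictions of triple external products, and coassociativity says that the
associator of algebras intertwines the two extension structures. -/
theorem assoc_act (a : A.alg.carrier) (t : (M.carrier ⊗[k] N.carrier) ⊗[k] P.carrier) :
    TensorProduct.assoc k M.carrier N.carrier P.carrier
      ((tensor c.comul (tensor c.comul M N) P).act a t) =
    (tensor c.comul M (tensor c.comul N P)).act a
      (TensorProduct.assoc k M.carrier N.carrier P.carrier t) := by
  have h₁ := act_eq_of_eq (tensor_tensor_left c.comul M N P) rfl a t
  have h₂ := act_eq_of_eq (tensor_tensor_right c.comul M N P) rfl a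
    (TensorProduct.assoc k M.carrier N.carrier P.carrier t)
  have h₃ := (NdI.coassoc_iff c.comul).1 c.comul_assoc
  refine (congrArg _ h₁).trans (Eq.trans ?_ h₂.symm)
  exact res_map (M := box (box M N) P) (N := box M (box N P))
    (TensorProduct.assoc k A.alg.carrier A.alg.carrier A.alg.carrier).toLinearMap
    (TensorProduct.assoc k M.carrier N.carrier P.carrier).toLinearMap
    (assoc_map₂ M.act N.act P.act) h₃ a t

theorem lid_act (a : A.alg.carrier) (t : k ⊗[k] M.carrier) :
    TensorProduct.lid k M.carrier ((tensor c.comul (unit c.counit) M).act a t) =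
      M.act a (TensorProduct.lid k M.carrier t) := by
  have h₁ := act_eq_of_eq (tensor_unit_left c.comul c.counit M) rfl a t
  have h₃ := (NdI.left_counit_iff c.comul c.counit).1 c.counit_comul
  refine (congrArg _ h₁).trans (Eq.trans ?_ (res_refl_act M a _))
  exact res_map (M := box (baseModule k) M) (TensorProduct.lid k A.alg.carrier).toLinearMap
    (TensorProduct.lid k M.carrier).toLinearMap (lid_map₂ M.act) h₃ a t

theorem rid_act (a : A.alg.carrier) (t : M.carrier ⊗[k] k) :
    TensorProduct.rid k M.carrier ((tensor c.comul M (unit c.counit)).act a t) =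
      M.act a (TensorProduct.rid k M.carrier t) := by
  have h₁ := act_eq_of_eq (tensor_unit_right c.comul c.counit M) rfl a t
  have h₃ := (NdI.right_counit_iff c.comul c.counit).1 c.comul_counit
  refine (congrArg _ h₁).trans (Eq.trans ?_ (res_refl_act M a _))
  exact res_map (M := box M (baseModule k)) (TensorProduct.rid k A.alg.carrier).toLinearMap
    (TensorProduct.rid k M.carrier).toLinearMap (rid_map₂ M.act) h₃ a t

/-- The monoidal operations on modules defined by a multiplier bialgebra. -/
@[reducible] noncomputable def monoidalStruct : MonoidalCategoryStruct (LMod A.alg) where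
  tensorObj := tensor c.comul
  tensorUnit := unit c.counit
  tensorHom f g := tensorMap c.comul f g
  whiskerLeft M _ _ g := tensorMap c.comul (𝟙 M) g
  whiskerRight f N := tensorMap c.comul f (𝟙 N)
  associator M N P := isoMk (TensorProduct.assoc k M.carrier N.carrier P.carrier)
    (assoc_act c M N P)
  leftUnitor M := isoMk (TensorProduct.lid k M.carrier) (lid_act c M)
  rightUnitor M := isoMk (TensorProduct.rid k M.carrier) (rid_act c M)

/-- The forgetful functor to `k`-modules preserves the monoidal operations. -/
noncomputable def inducingData : letI := monoidalStruct c
    Monoidal.InducingFunctorData (forget A.alg) :=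
  letI := monoidalStruct c
  { μIso := fun _ _ => Iso.refl _
    εIso := Iso.refl _
    whiskerLeft_eq := fun _ _ _ _ => rfl
    whiskerRight_eq := fun _ _ => rfl
    tensorHom_eq := fun _ _ => rfl
    associator_eq := fun _ _ _ => ModuleCat.hom_ext (TensorProduct.ext_threefold fun _ _ _ => rfl)
    leftUnitor_eq := fun _ => ModuleCat.hom_ext (TensorProduct.ext' fun _ _ => rfl)
    rightUnitor_eq := fun _ => ModuleCat.hom_ext (TensorProduct.ext' fun _ _ => rfl) }

/-- The monoidal category of modules over a multiplier bialgebra. -/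
@[reducible] noncomputable def monoidal : MonoidalCategory (LMod A.alg) :=
  letI := monoidalStruct c
  Monoidal.induced (forget A.alg) (inducingData c)

theorem isStrictMonoidal_forget : letI := monoidal c; IsStrictMonoidal (forget A.alg) :=
  letI := monoidalStruct c
  IsStrictMonoidal.of_induced (forget A.alg) (inducingData c) rfl (fun _ _ => rfl) rfl
    (fun _ _ => rfl)

end LMod

/-! ### Recovering the comonoid from a strict monoidal structure on left modules -/

namespace LMod

/-- A non-degenerate idempotent algebra as a module over itself. -/
@[reducible] def regular (A : NdI k) : LMod A.alg :=
  ⟨A.alg.carrier, A.alg.mul, A.alg.mul_assoc, A.projective, A.idem, A.nondeg_left⟩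

theorem res_regular_act {B A : NdI k} (f : B ⟶ A) (b : B.alg.carrier) (a : A.alg.carrier) :
    (res f (regular A)).act b a = ExtStr.left f b a := by
  refine A.idem.induction (q := fun a => (res f (regular A)).act b a = ExtStr.left f b a)
    (fun x y => ?_) (fun x y hx hy => ?_) a
  · exact (res_act f (regular A) b x y).trans (ExtStr.mul_left f b x y).symm
  · rw [map_add, map_add, hx, hy]

variable {A : NdI k}

/-- The module map `a ↦ a · m`. -/
def orbit (M : LMod A.alg) (m : M.carrier) : regular A ⟶ M :=
  ⟨ModuleCat.ofHom (M.act.flip m), fun a b => M.mul_act a b m⟩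

/-- Idempotency of both modules: the elements `bm ⊗ cn` span the tensor product. -/
theorem tensor_linearMap_ext {A A' : NUAlg k} {M : LMod A} {N : LMod A'} {P : Type u}
    [AddCommGroup P] [Module k P] {φ ψ : M.carrier ⊗[k] N.carrier →ₗ[k] P}
    (h : ∀ b m c n, φ (M.act b m ⊗ₜ N.act c n) = ψ (M.act b m ⊗ₜ N.act c n)) : φ = ψ := by
  refine TensorProduct.ext' fun x y => ?_
  refine M.idem.induction (q := fun x => φ (x ⊗ₜ y) = ψ (x ⊗ₜ y)) (fun b m => ?_)
    (fun x x' hx hx' => by rw [TensorProduct.add_tmul, map_add, map_add, hx, hx']) x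
  exact N.idem.induction (q := fun y => φ (M.act b m ⊗ₜ y) = ψ (M.act b m ⊗ₜ y))
    (fun c n => h b m c n)
    (fun x x' hx hx' => by rw [TensorProduct.tmul_add, map_add, map_add, hx, hx']) y

/-- A strict monoidal structure on modules is determined on objects by the tensor product of the
regular module with itself. -/
theorem tensorObj_eq (m : MonoidalCategory (LMod A.alg)) (h : IsStrictMonoidal (forget A.alg))
    (Δ : A ⟶ A ⊗ A) (hΔ : regular A ⊗ regular A = res Δ (regular (A ⊗ A))) (M N : LMod A.alg) :
    M ⊗ N = tensor Δ M N := by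
  symm
  refine ext_act (h.tensor_eq M N) fun a t => ?_
  refine LinearMap.congr_fun (tensor_linearMap_ext (M := M) (N := N)
    (φ := (eqToHom (h.tensor_eq M N)).hom ∘ₗ (tensor Δ M N).act a)
    (ψ := (M ⊗ N).act a ∘ₗ (eqToHom (h.tensor_eq M N)).hom) fun b m c n => ?_) t
  -- Strictness: the tensor product of two orbit maps is the ordinary one, up to the identification
  -- of carriers.
  have hE : ∀ s : A.alg.carrier ⊗[k] A.alg.carrier,
      (orbit M m ⊗ₘ orbit N n).hom (eqToHom (h.tensor_eq (regular A) (regular A)) s) =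
        eqToHom (h.tensor_eq M N) (TensorProduct.map (M.act.flip m) (N.act.flip n) s) := by
    intro s
    have := h.map_tensorHom (orbit M m) (orbit N n)
    rw [← cancel_epi (eqToHom (h.tensor_eq (regular A) (regular A))), eqToHom_trans_assoc,
      eqToHom_refl, Category.id_comp] at this
    exact LinearMap.congr_fun (congrArg ModuleCat.Hom.hom this) s
  have h₁ := act_eq_of_eq hΔ.symm (h.tensor_eq (regular A) (regular A)) a (b ⊗ₜ c)
  rw [res_regular_act] at h₁
  have h₂ := (orbit M m ⊗ₘ orbit N n).map_act a (eqToHom (h.tensor_eq (regular A) (regular A))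
    (b ⊗ₜ[k] c))
  -- The two sides are the image of `a · (b ⊗ c)` under the tensor product of the orbit maps, and
  -- `a` acting on the image of `b ⊗ c`; they agree because that map is `A`-linear.
  exact ((congrArg _ (tensor_act_tmul Δ M N a b c m n)).trans ((hE _).symm.trans
    (congrArg _ h₁))).trans (h₂.trans (congrArg _ (hE (b ⊗ₜ c))))

/-- The associator of the given structure is `A`-linear, and strictness makes its underlying map the
usual associator. -/
theorem assoc_act_of_isStrictMonoidal (m : MonoidalCategory (LMod A.alg))
    (h : IsStrictMonoidal (forget A.alg)) (Δ : A ⟶ A ⊗ A)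
    (hΔ : ∀ M N : LMod A.alg, M ⊗ N = tensor Δ M N) (M N P : LMod A.alg) (a : A.alg.carrier)
    (t : (M.carrier ⊗[k] N.carrier) ⊗[k] P.carrier) :
    TensorProduct.assoc k M.carrier N.carrier P.carrier
      ((tensor Δ (tensor Δ M N) P).act a t) =
    (tensor Δ M (tensor Δ N P)).act a
      (TensorProduct.assoc k M.carrier N.carrier P.carrier t) := by
  replace hΔ : m.tensorObj = tensor Δ := funext fun M => funext fun N => hΔ M N
  have hα := h.map_associator M N P
  obtain @⟨s⟩ := m
  obtain ⟨o, wl, wr, th, un, al, lu, ru⟩ := s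
  subst hΔ
  -- After the substitution the carriers agree definitionally, so the `eqToHom` factors in `hα`
  -- reduce to identities.
  have e : (al M N P).hom.hom.hom =
      (TensorProduct.assoc k M.carrier N.carrier P.carrier).toLinearMap :=
    TensorProduct.ext_threefold fun x y z =>
      LinearMap.congr_fun (congrArg ModuleCat.Hom.hom hα) ((x ⊗ₜ y) ⊗ₜ z)
  exact (LinearMap.congr_fun e _).symm.trans (((al M N P).hom.map_act a t).trans
    (congrArg _ (LinearMap.congr_fun e t)))

theorem lid_act_of_isStrictMonoidal (m : MonoidalCategory (LMod A.alg))
    (h : IsStrictMonoidal (forget A.alg)) (Δ : A ⟶ A ⊗ A) (ε : A ⟶ 𝟙_ (NdI k))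
    (hΔ : ∀ M N : LMod A.alg, M ⊗ N = tensor Δ M N) (hε : 𝟙_ (LMod A.alg) = unit ε)
    (M : LMod A.alg) (a : A.alg.carrier) (t : k ⊗[k] M.carrier) :
    TensorProduct.lid k M.carrier ((tensor Δ (unit ε) M).act a t) =
      M.act a (TensorProduct.lid k M.carrier t) := by
  replace hΔ : m.tensorObj = tensor Δ := funext fun M => funext fun N => hΔ M N
  have hl := h.map_leftUnitor M
  obtain @⟨s⟩ := m
  obtain ⟨o, wl, wr, th, un, al, lu, ru⟩ := s
  replace hε : un = unit ε := hε
  subst hΔ hε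
  have e : (lu M).hom.hom.hom = (TensorProduct.lid k M.carrier).toLinearMap :=
    TensorProduct.ext' fun r x =>
      LinearMap.congr_fun (congrArg ModuleCat.Hom.hom hl) (r ⊗ₜ x)
  exact (LinearMap.congr_fun e _).symm.trans (((lu M).hom.map_act a t).trans
    (congrArg _ (LinearMap.congr_fun e t)))

theorem rid_act_of_isStrictMonoidal (m : MonoidalCategory (LMod A.alg))
    (h : IsStrictMonoidal (forget A.alg)) (Δ : A ⟶ A ⊗ A) (ε : A ⟶ 𝟙_ (NdI k))
    (hΔ : ∀ M N : LMod A.alg, M ⊗ N = tensor Δ M N) (hε : 𝟙_ (LMod A.alg) = unit ε)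
    (M : LMod A.alg) (a : A.alg.carrier) (t : M.carrier ⊗[k] k) :
    TensorProduct.rid k M.carrier ((tensor Δ M (unit ε)).act a t) =
      M.act a (TensorProduct.rid k M.carrier t) := by
  replace hΔ : m.tensorObj = tensor Δ := funext fun M => funext fun N => hΔ M N
  have hr := h.map_rightUnitor M
  obtain @⟨s⟩ := m
  obtain ⟨o, wl, wr, th, un, al, lu, ru⟩ := s
  replace hε : un = unit ε := hε
  subst hΔ hε
  have e : (ru M).hom.hom.hom = (TensorProduct.rid k M.carrier).toLinearMap :=
    TensorProduct.ext' fun x r =>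
      LinearMap.congr_fun (congrArg ModuleCat.Hom.hom hr) (x ⊗ₜ r)
  exact (LinearMap.congr_fun e _).symm.trans (((ru M).hom.map_act a t).trans
    (congrArg _ (LinearMap.congr_fun e t)))

/-- The comonoid determined by a strict monoidal structure on modules. -/
@[reducible] noncomputable def comonObj (m : MonoidalCategory (LMod A.alg))
    (h : IsStrictMonoidal (forget A.alg)) (Δ : A ⟶ A ⊗ A) (ε : A ⟶ 𝟙_ (NdI k))
    (hΔ : ∀ M N : LMod A.alg, M ⊗ N = tensor Δ M N) (hε : 𝟙_ (LMod A.alg) = unit ε) :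
    ComonObj A where
  comul := Δ
  counit := ε
  comul_assoc := by
    refine (NdI.coassoc_iff Δ).2 fun a x => ?_
    -- On regular modules the restricted action is the left action of the extension structure
    -- itself, so linearity of the associator becomes coassociativity.
    have h₀ := assoc_act_of_isStrictMonoidal m h Δ hΔ (regular A) (regular A) (regular A) a x
    have h₁ := act_eq_of_eq (tensor_tensor_left Δ (regular A) (regular A) (regular A)) rfl a x
    have h₂ := act_eq_of_eq (tensor_tensor_right Δ (regular A) (regular A) (regular A)) rfl a
      (TensorProduct.assoc k A.alg.carrier A.alg.carrier A.alg.carrier x)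
    have h₃ := res_regular_act (A := (A ⊗ A) ⊗ A) (Δ ≫ Δ ▷ A) a x
    have h₄ := res_regular_act (A := A ⊗ (A ⊗ A)) (Δ ≫ A ◁ Δ) a
      (TensorProduct.assoc k A.alg.carrier A.alg.carrier A.alg.carrier x)
    exact (congrArg _ (h₁.trans h₃)).symm.trans (h₀.trans (h₂.trans h₄))
  counit_comul := by
    refine (NdI.left_counit_iff Δ ε).2 fun a x => ?_
    have h₀ := lid_act_of_isStrictMonoidal m h Δ ε hΔ hε (regular A) a x
    have h₁ := act_eq_of_eq (tensor_unit_left Δ ε (regular A)) rfl a x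
    have h₃ := res_regular_act (A := 𝟙_ (NdI k) ⊗ A) (Δ ≫ ε ▷ A) a x
    exact (congrArg _ (h₁.trans h₃)).symm.trans h₀
  comul_counit := by
    refine (NdI.right_counit_iff Δ ε).2 fun a x => ?_
    have h₀ := rid_act_of_isStrictMonoidal m h Δ ε hΔ hε (regular A) a x
    have h₁ := act_eq_of_eq (tensor_unit_right Δ ε (regular A)) rfl a x
    have h₃ := res_regular_act (A := A ⊗ 𝟙_ (NdI k)) (Δ ≫ A ◁ ε) a x
    exact (congrArg _ (h₁.trans h₃)).symm.trans h₀

end LMod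

/-! ### The comonoid laws in terms of right actions -/

namespace NdI

variable {A : NdI k} {Δ : A ⟶ A ⊗ A} {ε : A ⟶ 𝟙_ (NdI k)}

theorem assoc_right (h : Δ ≫ A ◁ Δ = Δ ≫ Δ ▷ A ≫ (α_ A A A).hom)
    (x : ((A ⊗ A) ⊗ A).alg.carrier) (a : A.alg.carrier) :
    TensorProduct.assoc k A.alg.carrier A.alg.carrier A.alg.carrier
      (ExtStr.right (Δ ≫ Δ ▷ A) x a) = ExtStr.right (Δ ≫ A ◁ Δ)
        (TensorProduct.assoc k A.alg.carrier A.alg.carrier A.alg.carrier x) a :=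
  ExtStr.right_comm_of_left (A := (A ⊗ A) ⊗ A) (R := A ⊗ (A ⊗ A)) _
    (assoc_map₂ A.alg.mul A.alg.mul A.alg.mul) _ _ ((coassoc_iff Δ).1 h) x a

theorem lid_right (h : Δ ≫ ε ▷ A = (λ_ A).inv) (x : (𝟙_ (NdI k) ⊗ A).alg.carrier)
    (a : A.alg.carrier) :
    TensorProduct.lid k A.alg.carrier (ExtStr.right (Δ ≫ ε ▷ A) x a) =
      ExtStr.right (𝟙 A) (TensorProduct.lid k A.alg.carrier x) a :=
  ExtStr.right_comm_of_left (A := 𝟙_ (NdI k) ⊗ A) _ (lid_map₂ A.alg.mul) _ _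
    ((left_counit_iff Δ ε).1 h) x a

theorem rid_right (h : Δ ≫ A ◁ ε = (ρ_ A).inv) (x : (A ⊗ 𝟙_ (NdI k)).alg.carrier)
    (a : A.alg.carrier) :
    TensorProduct.rid k A.alg.carrier (ExtStr.right (Δ ≫ A ◁ ε) x a) =
      ExtStr.right (𝟙 A) (TensorProduct.rid k A.alg.carrier x) a :=
  ExtStr.right_comm_of_left (A := A ⊗ 𝟙_ (NdI k)) _ (rid_map₂ A.alg.mul) _ _
    ((right_counit_iff Δ ε).1 h) x a

end NdI

/-! ### Right modules: restriction, tensor products and the monoidal category -/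

namespace RMod

section Res

variable {B A : NUAlg k} (f : ExtStr B A) (M : RMod A)

theorem act_injective {x y : M.carrier} (h : ∀ a, M.act x a = M.act y a) : x = y :=
  sub_eq_zero.1 (M.nondeg _ fun a => by rw [map_sub, LinearMap.sub_apply, h, sub_self])

/-- Mirror image of the left case: for `m = Σ mᵢaᵢ` the element is `Σ mᵢ(aᵢ · b)`. -/
theorem exists_act (m : M.carrier) (b : B.carrier) :
    ∃ s, ∀ a, M.act s a = M.act m (f.left b a) := by
  refine M.idem.induction (q := fun m => ∃ s, ∀ a, M.act s a = M.act m (f.left b a))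
    (fun m' a' => ⟨M.act m' (f.right a' b), fun a => ?_⟩) ?_ m
  · rw [← M.act_mul, ← M.act_mul, f.balanced]
  · rintro x y ⟨s, hs⟩ ⟨t, ht⟩
    exact ⟨s + t, fun a => by rw [map_add, LinearMap.add_apply, hs, ht, map_add,
      LinearMap.add_apply]⟩

/-- The `B`-action on an `A`-module obtained from a `B`-extension structure on `A`. -/
noncomputable def resAct : M.carrier →ₗ[k] B.carrier →ₗ[k] M.carrier :=
  LinearMap.mk₂ k (fun m b => (exists_act f M m b).choose)
    (fun m m' b => M.act_injective fun a => by
      rw [(exists_act f M (m + m') b).choose_spec, map_add, map_add, LinearMap.add_apply,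
        LinearMap.add_apply, (exists_act f M m b).choose_spec,
        (exists_act f M m' b).choose_spec])
    (fun t m b => M.act_injective fun a => by
      rw [(exists_act f M (t • m) b).choose_spec, map_smul, map_smul, LinearMap.smul_apply,
        LinearMap.smul_apply, (exists_act f M m b).choose_spec])
    (fun m b b' => M.act_injective fun a => by
      rw [(exists_act f M m (b + b')).choose_spec, map_add, map_add, LinearMap.add_apply,
        LinearMap.add_apply, map_add, (exists_act f M m b).choose_spec,
        (exists_act f M m b').choose_spec])
    (fun t m b => M.act_injective fun a => by
      rw [(exists_act f M m (t • b)).choose_spec, map_smul, map_smul, LinearMap.smul_apply,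
        LinearMap.smul_apply, map_smul, (exists_act f M m b).choose_spec])

theorem act_resAct (m : M.carrier) (b : B.carrier) (a : A.carrier) :
    M.act (resAct f M m b) a = M.act m (f.left b a) :=
  (exists_act f M m b).choose_spec a

theorem resAct_act (m : M.carrier) (a : A.carrier) (b : B.carrier) :
    resAct f M (M.act m a) b = M.act m (f.right a b) :=
  M.act_injective fun a' => by
    rw [act_resAct, ← M.act_mul, ← M.act_mul, f.balanced]

/-- Restriction of a module along a `B`-extension structure on `A`. -/
@[reducible] noncomputable def res : RMod B where
  carrier := M.carrier
  act := resAct f M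
  act_mul m b b' := M.act_injective fun a => by simp only [act_resAct, f.left_mul]
  projective := M.projective
  idem := isIdem_of_mem M.idem fun m a => by
    refine f.idem_right.induction (q := fun a => M.act m a ∈ Submodule.span k _)
      (fun a b => ?_) (fun x y hx hy => ?_) a
    · exact Submodule.subset_span ⟨M.act m a, b, resAct_act f M m a b⟩
    · rw [map_add]; exact Submodule.add_mem _ hx hy
  nondeg m hm := M.nondeg m fun a =>
    f.idem_left.induction (q := fun a => M.act m a = 0)
      (fun b a => by rw [← act_resAct, hm, map_zero, LinearMap.zero_apply])
      (fun x y hx hy => by rw [map_add, hx, hy, add_zero]) a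

theorem res_act (m : M.carrier) (a : A.carrier) (b : B.carrier) :
    (res f M).act (M.act m a) b = M.act m (f.right a b) := resAct_act f M m a b

end Res

theorem res_map {A B C : NUAlg k} {f : ExtStr A B} {g : ExtStr A C} {M : RMod B} {N : RMod C}
    (e : B.carrier →ₗ[k] C.carrier) (u : M.carrier →ₗ[k] N.carrier)
    (hu : ∀ m b, u (M.act m b) = N.act (u m) (e b))
    (he : ∀ b a, e (f.right b a) = g.right (e b) a) (m : M.carrier) (a : A.carrier) :
    u ((res f M).act m a) = (res g N).act (u m) a := by
  refine M.idem.induction (q := fun m => u ((res f M).act m a) = (res g N).act (u m) a)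
    (fun m b => ?_) (fun x y hx hy => ?_) m
  · rw [res_act, hu, hu, res_act, he]
  · simp only [map_add, LinearMap.add_apply, hx, hy]

/-- The external tensor product of modules over two algebras. -/
@[reducible] noncomputable def box {A A' : NUAlg k} (M : RMod A) (N : RMod A') :
    RMod (A.tensor A') where
  carrier := ModuleCat.of k (M.carrier ⊗[k] N.carrier)
  act := TensorProduct.map₂ M.act N.act
  act_mul x a b := (map₂_assoc (fun m a b => (M.act_mul m a b).symm)
    (fun n a b => (N.act_mul n a b).symm) x a b).symm
  projective := inferInstanceAs (Module.Projective k (M.carrier ⊗[k] N.carrier))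
  idem := M.idem.map₂ N.idem
  nondeg := NondegFst.map₂ M.nondeg N.nondeg

theorem map_box {A A' : NUAlg k} {M M' : RMod A} {N N' : RMod A'} (f : M ⟶ M') (g : N ⟶ N')
    (t : M.carrier ⊗[k] N.carrier) (x : A.carrier ⊗[k] A'.carrier) :
    TensorProduct.map f.hom.hom g.hom.hom ((box M N).act t x) =
      (box M' N').act (TensorProduct.map f.hom.hom g.hom.hom t) x := by
  refine LinearMap.congr_fun (LinearMap.congr_fun
    (f := (TensorProduct.map₂ M.act N.act).compr₂ (TensorProduct.map f.hom.hom g.hom.hom))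
    (g := TensorProduct.map₂ M'.act N'.act ∘ₗ TensorProduct.map f.hom.hom g.hom.hom)
    ?_ t) x
  refine TensorProduct.ext' fun m n => TensorProduct.ext' fun a a' => ?_
  simpa using congrArg₂ (· ⊗ₜ[k] ·) (f.map_act m a) (g.map_act n a')

theorem ext_act {A : NUAlg k} {M N : RMod A} (h : M.carrier = N.carrier)
    (H : ∀ x a, eqToHom h (M.act x a) = N.act (eqToHom h x) a) : M = N := by
  obtain ⟨M, actM, _, _, _, _⟩ := M
  obtain ⟨N, actN, _, _, _, _⟩ := N
  dsimp only at h
  subst h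
  obtain rfl : actM = actN := LinearMap.ext₂ H
  rfl

theorem act_eq_of_eq {A : NUAlg k} {M N : RMod A} (h : M = N) (hc : M.carrier = N.carrier)
    (x : M.carrier) (a : A.carrier) : eqToHom hc (M.act x a) = N.act (eqToHom hc x) a := by
  subst h
  rfl

theorem res_comp {C B A : NUAlg k} (f : ExtStr C B) (g : ExtStr B A) (M : RMod A) :
    res (f.comp g) M = res f (res g M) := by
  refine ext_act rfl fun m c => ?_
  change (res (f.comp g) M).act m c = (res f (res g M)).act m c
  refine M.idem.induction (q := fun m => (res (f.comp g) M).act m c = (res f (res g M)).act m c)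
    (fun m a => ?_) (fun x y hx hy => ?_) m
  · refine g.idem_right.induction (q := fun a => (res (f.comp g) M).act (M.act m a) c =
      (res f (res g M)).act (M.act m a) c) (fun a b => ?_) (fun x y hx hy => ?_) a
    · rw [res_act, show (f.comp g).right (g.right a b) c = g.right a (f.right b c) from
        ExtStr.compRight_right f g a b c, ← res_act g, ← res_act g]
      exact (res_act f (res g M) _ b c).symm
    · simp only [map_add, LinearMap.add_apply, hx, hy]
  · simp only [map_add, LinearMap.add_apply, hx, hy]

theorem res_refl_act {A : NdI k} (M : RMod A.alg) (m : M.carrier) (a : A.alg.carrier) :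
    (res (ExtStr.refl A) M).act m a = M.act m a := by
  refine M.idem.induction (q := fun m => (res (ExtStr.refl A) M).act m a = M.act m a)
    (fun m b => ?_) (fun x y hx hy => ?_) m
  · rw [res_act, ← M.act_mul]; rfl
  · simp only [map_add, LinearMap.add_apply, hx, hy]

theorem res_refl {A : NdI k} (M : RMod A.alg) : res (ExtStr.refl A) M = M :=
  ext_act rfl (res_refl_act M)

theorem box_res {B B' : NUAlg k} {A A' : NdI k} (f : ExtStr B A.alg) (g : ExtStr B' A'.alg)
    (M : RMod A.alg) (N : RMod A'.alg) :
    box (res f M) (res g N) = res (f.tensor g) (box M N) := by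
  refine ext_act rfl fun t x => ?_
  change (box (res f M) (res g N)).act t x = (res (f.tensor g) (box M N)).act t x
  refine (box M N).idem.induction (q := fun t => (box (res f M) (res g N)).act t x =
    (res (f.tensor g) (box M N)).act t x) (fun t y => ?_) (fun x y hx hy => ?_) t
  · rw [res_act]
    exact map₂_assoc (fun m a b => res_act f M m a b) (fun m a b => res_act g N m a b) t y x
  · simp only [map_add, LinearMap.add_apply, hx, hy]

/-- A bijective linear map compatible with the actions is an isomorphism of modules. -/
def isoMk {A : NUAlg k} {M N : RMod A} (e : M.carrier ≃ₗ[k] N.carrier)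
    (h : ∀ m a, e (M.act m a) = N.act (e m) a) : M ≅ N where
  hom := ⟨ModuleCat.ofHom e.toLinearMap, fun m a => h m a⟩
  inv := ⟨ModuleCat.ofHom e.symm.toLinearMap, fun n a =>
    e.injective ((e.apply_symm_apply _).trans (by
      rw [h]; exact congrArg (N.act · a) (e.apply_symm_apply n).symm))⟩
  hom_inv_id := Hom.ext (ModuleCat.hom_ext (LinearMap.ext e.symm_apply_apply))
  inv_hom_id := Hom.ext (ModuleCat.hom_ext (LinearMap.ext e.apply_symm_apply))

instance (A : NUAlg k) : (forget A).Faithful where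
  map_injective h := Hom.ext h

section Tensor

variable {A : NUAlg k} (Δ : ExtStr A (A.tensor A)) (ε : ExtStr A (NUAlg.base k))

/-- The tensor product of modules defined by an extension structure on `A ⊗ A`. -/
@[reducible] noncomputable def tensor (M N : RMod A) : RMod A := res Δ (box M N)

/-- The module `k` defined by an extension structure on `k`. -/
@[reducible] def unit : RMod A where
  carrier := ModuleCat.of k k
  act := ε.right
  act_mul := ε.right_mul
  projective := inferInstanceAs (Module.Projective k k)
  idem := ε.idem_right
  nondeg := ε.nondeg_right

/-- The tensor product of morphisms of modules. -/
noncomputable def tensorMap {M M' N N' : RMod A} (f : M ⟶ M') (g : N ⟶ N') :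
    tensor Δ M N ⟶ tensor Δ M' N' :=
  ⟨ModuleCat.ofHom (TensorProduct.map f.hom.hom g.hom.hom),
    res_map (M := box M N) (N := box M' N') LinearMap.id _ (map_box f g) (fun _ _ => rfl)⟩

theorem tensor_act_tmul (M N : RMod A) (a b c : A.carrier) (m : M.carrier) (n : N.carrier) :
    (tensor Δ M N).act (M.act m b ⊗ₜ[k] N.act n c) a =
      TensorProduct.map (M.act m) (N.act n) (Δ.right (b ⊗ₜ c) a) :=
  res_act Δ (box M N) (m ⊗ₜ n) (b ⊗ₜ c) a

end Tensor

/-- The base ring as a module over itself. -/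
@[reducible] def baseModule (k : Type u) [CommRing k] : RMod (NUAlg.base k) :=
  ⟨ModuleCat.of k k, LinearMap.mul k k, fun a b c => ((NUAlg.base k).mul_assoc a b c).symm,
    (NdI.base k).projective, (NdI.base k).idem, (NdI.base k).nondeg_right⟩

theorem res_baseModule {A : NUAlg k} (ε : ExtStr A (NUAlg.base k)) :
    res ε (baseModule k) = unit ε := by
  refine ext_act rfl fun x a => ?_
  have h := res_act ε (baseModule k) (1 : k) x a
  have h1 : (baseModule k).act (1 : k) x = x := one_mul (M := k) x
  have h2 : (baseModule k).act (1 : k) (ε.right x a) = ε.right x a := one_mul (M := k) _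
  rw [h1, h2] at h
  exact h

/-- A non-degenerate idempotent algebra as a module over itself. -/
@[reducible] def regular (A : NdI k) : RMod A.alg :=
  ⟨A.alg.carrier, A.alg.mul, fun a b c => (A.alg.mul_assoc a b c).symm, A.projective, A.idem,
    A.nondeg_right⟩

theorem res_regular_act {B A : NdI k} (f : B ⟶ A) (a : A.alg.carrier) (b : B.alg.carrier) :
    (res f (regular A)).act a b = ExtStr.right f a b := by
  refine A.idem.induction (q := fun a => (res f (regular A)).act a b = ExtStr.right f a b)
    (fun x y => ?_) (fun x y hx hy => ?_) a
  · exact (res_act f (regular A) x y b).trans (ExtStr.mul_right f x y b).symm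
  · rw [map_add, map_add, LinearMap.add_apply, LinearMap.add_apply, hx, hy]

variable {A : NdI k}

/-- The module map `a ↦ m · a`. -/
def orbit (M : RMod A.alg) (m : M.carrier) : regular A ⟶ M :=
  ⟨ModuleCat.ofHom (M.act m), fun a b => M.act_mul m a b⟩

theorem tensor_linearMap_ext {A A' : NUAlg k} {M : RMod A} {N : RMod A'} {P : Type u}
    [AddCommGroup P] [Module k P] {φ ψ : M.carrier ⊗[k] N.carrier →ₗ[k] P}
    (h : ∀ m b n c, φ (M.act m b ⊗ₜ N.act n c) = ψ (M.act m b ⊗ₜ N.act n c)) : φ = ψ := by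
  refine TensorProduct.ext' fun x y => ?_
  refine M.idem.induction (q := fun x => φ (x ⊗ₜ y) = ψ (x ⊗ₜ y)) (fun m b => ?_)
    (fun x x' hx hx' => by rw [TensorProduct.add_tmul, map_add, map_add, hx, hx']) x
  exact N.idem.induction (q := fun y => φ (M.act m b ⊗ₜ y) = ψ (M.act m b ⊗ₜ y))
    (fun n c => h m b n c)
    (fun x x' hx hx' => by rw [TensorProduct.tmul_add, map_add, map_add, hx, hx']) y

/-- A strict monoidal structure on modules is determined on objects by the tensor product of the
regular module with itself. -/
theorem tensorObj_eq (m : MonoidalCategory (RMod A.alg)) (h : IsStrictMonoidal (forget A.alg))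
    (Δ : A ⟶ A ⊗ A) (hΔ : regular A ⊗ regular A = res Δ (regular (A ⊗ A))) (M N : RMod A.alg) :
    M ⊗ N = tensor Δ M N := by
  symm
  refine ext_act (h.tensor_eq M N) fun t a => ?_
  refine LinearMap.congr_fun (tensor_linearMap_ext (M := M) (N := N)
    (φ := (eqToHom (h.tensor_eq M N)).hom ∘ₗ (tensor Δ M N).act.flip a)
    (ψ := (M ⊗ N).act.flip a ∘ₗ (eqToHom (h.tensor_eq M N)).hom) fun m b n c => ?_) t
  have hE : ∀ s : A.alg.carrier ⊗[k] A.alg.carrier,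
      (orbit M m ⊗ₘ orbit N n).hom (eqToHom (h.tensor_eq (regular A) (regular A)) s) =
        eqToHom (h.tensor_eq M N) (TensorProduct.map (M.act m) (N.act n) s) := by
    intro s
    have := h.map_tensorHom (orbit M m) (orbit N n)
    rw [← cancel_epi (eqToHom (h.tensor_eq (regular A) (regular A))), eqToHom_trans_assoc,
      eqToHom_refl, Category.id_comp] at this
    exact LinearMap.congr_fun (congrArg ModuleCat.Hom.hom this) s
  have h₁ := act_eq_of_eq hΔ.symm (h.tensor_eq (regular A) (regular A)) (b ⊗ₜ c) a
  rw [res_regular_act] at h₁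
  have h₂ := (orbit M m ⊗ₘ orbit N n).map_act (eqToHom (h.tensor_eq (regular A) (regular A))
    (b ⊗ₜ[k] c)) a
  exact ((congrArg _ (tensor_act_tmul Δ M N a b c m n)).trans ((hE _).symm.trans
    (congrArg _ h₁))).trans (h₂.trans (congrArg ((M ⊗ N).act · a) (hE (b ⊗ₜ c))))

section

variable (Δ : A ⟶ A ⊗ A) (ε : A ⟶ 𝟙_ (NdI k)) (M N P : RMod A.alg)

theorem tensor_tensor_left :
    tensor Δ (tensor Δ M N) P = res (Δ ≫ Δ ▷ A : _ ⟶ _) (box (box M N) P) := by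
  refine Eq.trans ?_ (res_comp Δ (ExtStr.tensor Δ (ExtStr.refl A)) (box (box M N) P)).symm
  refine Eq.trans ?_ (congrArg (res Δ) (box_res (A := A.tensor A) Δ (ExtStr.refl A) (box M N) P))
  rw [res_refl]

theorem tensor_tensor_right :
    tensor Δ M (tensor Δ N P) = res (Δ ≫ A ◁ Δ : _ ⟶ _) (box M (box N P)) := by
  refine Eq.trans ?_ (res_comp Δ (ExtStr.tensor (ExtStr.refl A) Δ) (box M (box N P))).symm
  refine Eq.trans ?_ (congrArg (res Δ) (box_res (A' := A.tensor A) (ExtStr.refl A) Δ M (box N P)))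
  rw [res_refl]

theorem tensor_unit_left :
    tensor Δ (unit ε) M = res (Δ ≫ ε ▷ A : _ ⟶ _) (box (baseModule k) M) := by
  refine Eq.trans ?_ (res_comp Δ (ExtStr.tensor ε (ExtStr.refl A)) (box (baseModule k) M)).symm
  refine Eq.trans ?_ (congrArg (res Δ) (box_res (A := NdI.base k) ε (ExtStr.refl A)
    (baseModule k) M))
  rw [res_refl, res_baseModule]

theorem tensor_unit_right :
    tensor Δ M (unit ε) = res (Δ ≫ A ◁ ε : _ ⟶ _) (box M (baseModule k)) := by
  refine Eq.trans ?_ (res_comp Δ (ExtStr.tensor (ExtStr.refl A) ε) (box M (baseModule k))).symm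
  refine Eq.trans ?_ (congrArg (res Δ) (box_res (A' := NdI.base k) (ExtStr.refl A) ε M
    (baseModule k)))
  rw [res_refl, res_baseModule]

end

variable (c : ComonObj A) (M N P : RMod A.alg)

theorem assoc_act (t : (M.carrier ⊗[k] N.carrier) ⊗[k] P.carrier) (a : A.alg.carrier) :
    TensorProduct.assoc k M.carrier N.carrier P.carrier
      ((tensor c.comul (tensor c.comul M N) P).act t a) =
    (tensor c.comul M (tensor c.comul N P)).act
      (TensorProduct.assoc k M.carrier N.carrier P.carrier t) a := by
  have h₁ := act_eq_of_eq (tensor_tensor_left c.comul M N P) rfl t a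
  have h₂ := act_eq_of_eq (tensor_tensor_right c.comul M N P) rfl
    (TensorProduct.assoc k M.carrier N.carrier P.carrier t) a
  refine (congrArg _ h₁).trans (Eq.trans ?_ h₂.symm)
  exact res_map (M := box (box M N) P) (N := box M (box N P))
    (TensorProduct.assoc k A.alg.carrier A.alg.carrier A.alg.carrier).toLinearMap
    (TensorProduct.assoc k M.carrier N.carrier P.carrier).toLinearMap
    (assoc_map₂ M.act N.act P.act) (NdI.assoc_right c.comul_assoc) t a

theorem lid_act (t : k ⊗[k] M.carrier) (a : A.alg.carrier) :
    TensorProduct.lid k M.carrier ((tensor c.comul (unit c.counit) M).act t a) =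
      M.act (TensorProduct.lid k M.carrier t) a := by
  have h₁ := act_eq_of_eq (tensor_unit_left c.comul c.counit M) rfl t a
  refine (congrArg _ h₁).trans (Eq.trans ?_ (res_refl_act M _ a))
  exact res_map (M := box (baseModule k) M) (TensorProduct.lid k A.alg.carrier).toLinearMap
    (TensorProduct.lid k M.carrier).toLinearMap (lid_map₂ M.act)
    (NdI.lid_right c.counit_comul) t a

theorem rid_act (t : M.carrier ⊗[k] k) (a : A.alg.carrier) :
    TensorProduct.rid k M.carrier ((tensor c.comul M (unit c.counit)).act t a) =
      M.act (TensorProduct.rid k M.carrier t) a := by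
  have h₁ := act_eq_of_eq (tensor_unit_right c.comul c.counit M) rfl t a
  refine (congrArg _ h₁).trans (Eq.trans ?_ (res_refl_act M _ a))
  exact res_map (M := box M (baseModule k)) (TensorProduct.rid k A.alg.carrier).toLinearMap
    (TensorProduct.rid k M.carrier).toLinearMap (rid_map₂ M.act)
    (NdI.rid_right c.comul_counit) t a

/-- The monoidal operations on modules defined by a multiplier bialgebra. -/
@[reducible] noncomputable def monoidalStruct : MonoidalCategoryStruct (RMod A.alg) where
  tensorObj := tensor c.comul
  tensorUnit := unit c.counit
  tensorHom f g := tensorMap c.comul f g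
  whiskerLeft M _ _ g := tensorMap c.comul (𝟙 M) g
  whiskerRight f N := tensorMap c.comul f (𝟙 N)
  associator M N P := isoMk (TensorProduct.assoc k M.carrier N.carrier P.carrier)
    (assoc_act c M N P)
  leftUnitor M := isoMk (TensorProduct.lid k M.carrier) (lid_act c M)
  rightUnitor M := isoMk (TensorProduct.rid k M.carrier) (rid_act c M)

/-- The forgetful functor to `k`-modules preserves the monoidal operations. -/
noncomputable def inducingData : letI := monoidalStruct c
    Monoidal.InducingFunctorData (forget A.alg) :=
  letI := monoidalStruct c
  { μIso := fun _ _ => Iso.refl _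
    εIso := Iso.refl _
    whiskerLeft_eq := fun _ _ _ _ => rfl
    whiskerRight_eq := fun _ _ => rfl
    tensorHom_eq := fun _ _ => rfl
    associator_eq := fun _ _ _ => ModuleCat.hom_ext (TensorProduct.ext_threefold fun _ _ _ => rfl)
    leftUnitor_eq := fun _ => ModuleCat.hom_ext (TensorProduct.ext' fun _ _ => rfl)
    rightUnitor_eq := fun _ => ModuleCat.hom_ext (TensorProduct.ext' fun _ _ => rfl) }

/-- The monoidal category of modules over a multiplier bialgebra. -/
@[reducible] noncomputable def monoidal : MonoidalCategory (RMod A.alg) :=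
  letI := monoidalStruct c
  Monoidal.induced (forget A.alg) (inducingData c)

theorem isStrictMonoidal_forget : letI := monoidal c; IsStrictMonoidal (forget A.alg) :=
  letI := monoidalStruct c
  IsStrictMonoidal.of_induced (forget A.alg) (inducingData c) rfl (fun _ _ => rfl) rfl
    (fun _ _ => rfl)

end RMod

/-! ### The monoidal category of extensions -/

namespace AExt

instance (A : NUAlg k) : (toLMod A).Faithful where
  map_injective h := Hom.ext (congrArg LMod.Hom.hom h)

instance (A : NUAlg k) : (toRMod A).Faithful where
  map_injective h := Hom.ext (congrArg RMod.Hom.hom h)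

section Tensor

variable {A : NUAlg k} (Δ : ExtStr A (A.tensor A)) (ε : ExtStr A (NUAlg.base k))

/-- The tensor product of extensions defined by an extension structure on `A ⊗ A`. -/
@[reducible] noncomputable def tensor (P Q : AExt A) : AExt A where
  alg := P.alg.tensor Q.alg
  str := Δ.comp (P.str.tensor Q.str)
  projective := inferInstanceAs (Module.Projective k (P.alg.carrier ⊗[k] Q.alg.carrier))

/-- The algebra `k` with a given extension structure. -/
@[reducible] def unit : AExt A where
  alg := NUAlg.base k
  str := ε
  projective := inferInstanceAs (Module.Projective k k)

theorem map_tensor_mul {A B A' B' : NUAlg k} {f : A.carrier →ₗ[k] A'.carrier}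
    {g : B.carrier →ₗ[k] B'.carrier} (hf : ∀ x y, f (A.mul x y) = A'.mul (f x) (f y))
    (hg : ∀ x y, g (B.mul x y) = B'.mul (g x) (g y)) (x y : A.carrier ⊗[k] B.carrier) :
    TensorProduct.map f g ((A.tensor B).mul x y) =
      (A'.tensor B').mul (TensorProduct.map f g x) (TensorProduct.map f g y) := by
  refine LinearMap.congr_fun (LinearMap.congr_fun
    (f := (TensorProduct.map₂ A.mul B.mul).compr₂ (TensorProduct.map f g))
    (g := (TensorProduct.map₂ A'.mul B'.mul).compl₁₂ (TensorProduct.map f g)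
      (TensorProduct.map f g)) ?_ x) y
  refine TensorProduct.ext' fun a b => TensorProduct.ext' fun a' b' => ?_
  simp [hf, hg]

/-- The tensor product of morphisms of extensions. -/
noncomputable def tensorMap {P P' Q Q' : AExt A} (f : P ⟶ P') (g : Q ⟶ Q') :
    tensor Δ P Q ⟶ tensor Δ P' Q' where
  hom := ModuleCat.ofHom (TensorProduct.map f.hom.hom g.hom.hom)
  map_mul := map_tensor_mul f.map_mul g.map_mul
  -- The left action of a composite extension is definitionally the restricted module action, so
  -- linearity is inherited from modules; likewise on the right.
  map_left := (LMod.tensorMap Δ ((toLMod A).map f) ((toLMod A).map g)).map_act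
  map_right := (RMod.tensorMap Δ ((toRMod A).map f) ((toRMod A).map g)).map_act

/-- A bijective bilinear algebra map is an isomorphism of extensions. -/
def isoMk {P Q : AExt A} (e : P.alg.carrier ≃ₗ[k] Q.alg.carrier)
    (h : ∀ x y, e (P.alg.mul x y) = Q.alg.mul (e x) (e y))
    (hl : ∀ a x, e (P.str.left a x) = Q.str.left a (e x))
    (hr : ∀ x a, e (P.str.right x a) = Q.str.right (e x) a) : P ≅ Q where
  hom := ⟨ModuleCat.ofHom e.toLinearMap, h, hl, hr⟩
  inv := ⟨ModuleCat.ofHom e.symm.toLinearMap,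
    fun x y => e.injective ((e.apply_symm_apply _).trans ((congrArg₂ (fun x y => Q.alg.mul x y)
      (e.apply_symm_apply x).symm (e.apply_symm_apply y).symm).trans (h _ _).symm)),
    (LMod.isoMk (M := (toLMod A).obj P) (N := (toLMod A).obj Q) e hl).inv.map_act,
    (RMod.isoMk (M := (toRMod A).obj P) (N := (toRMod A).obj Q) e hr).inv.map_act⟩
  hom_inv_id := Hom.ext (ModuleCat.hom_ext (LinearMap.ext e.symm_apply_apply))
  inv_hom_id := Hom.ext (ModuleCat.hom_ext (LinearMap.ext e.apply_symm_apply))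

end Tensor

variable {A : NdI k} (c : ComonObj A)

/-- The monoidal operations on extensions defined by a multiplier bialgebra. -/
@[reducible] noncomputable def monoidalStruct : MonoidalCategoryStruct (AExt A.alg) where
  tensorObj := tensor c.comul
  tensorUnit := unit c.counit
  tensorHom f g := tensorMap c.comul f g
  whiskerLeft P _ _ g := tensorMap c.comul (𝟙 P) g
  whiskerRight f Q := tensorMap c.comul f (𝟙 Q)
  associator P Q R := isoMk (P := tensor c.comul (tensor c.comul P Q) R)
    (Q := tensor c.comul P (tensor c.comul Q R))
    (TensorProduct.assoc k P.alg.carrier Q.alg.carrier R.alg.carrier)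
    (assoc_map₂ P.alg.mul Q.alg.mul R.alg.mul)
    (LMod.assoc_act c ((toLMod _).obj P) ((toLMod _).obj Q) ((toLMod _).obj R))
    (RMod.assoc_act c ((toRMod _).obj P) ((toRMod _).obj Q) ((toRMod _).obj R))
  leftUnitor P := isoMk (P := tensor c.comul (unit c.counit) P)
    (TensorProduct.lid k P.alg.carrier) (lid_map₂ P.alg.mul)
    (LMod.lid_act c ((toLMod _).obj P)) (RMod.lid_act c ((toRMod _).obj P))
  rightUnitor P := isoMk (P := tensor c.comul P (unit c.counit))
    (TensorProduct.rid k P.alg.carrier) (rid_map₂ P.alg.mul)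
    (LMod.rid_act c ((toLMod _).obj P)) (RMod.rid_act c ((toRMod _).obj P))

/-- The forgetful functor to left modules preserves the monoidal operations. -/
noncomputable def inducingDataL : letI := monoidalStruct c; letI := LMod.monoidal c
    Monoidal.InducingFunctorData (toLMod A.alg) :=
  letI := monoidalStruct c
  letI := LMod.monoidal c
  { μIso := fun _ _ => Iso.refl _
    εIso := Iso.refl _
    whiskerLeft_eq := fun _ _ _ _ => rfl
    whiskerRight_eq := fun _ _ => rfl
    tensorHom_eq := fun _ _ => rfl
    associator_eq := fun _ _ _ => LMod.Hom.ext
      (ModuleCat.hom_ext (TensorProduct.ext_threefold fun _ _ _ => rfl))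
    leftUnitor_eq := fun _ => LMod.Hom.ext (ModuleCat.hom_ext (TensorProduct.ext' fun _ _ => rfl))
    rightUnitor_eq := fun _ =>
      LMod.Hom.ext (ModuleCat.hom_ext (TensorProduct.ext' fun _ _ => rfl)) }

/-- The forgetful functor to right modules preserves the monoidal operations. -/
noncomputable def inducingDataR : letI := monoidalStruct c; letI := RMod.monoidal c
    Monoidal.InducingFunctorData (toRMod A.alg) :=
  letI := monoidalStruct c
  letI := RMod.monoidal c
  { μIso := fun _ _ => Iso.refl _
    εIso := Iso.refl _
    whiskerLeft_eq := fun _ _ _ _ => rfl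
    whiskerRight_eq := fun _ _ => rfl
    tensorHom_eq := fun _ _ => rfl
    associator_eq := fun _ _ _ => RMod.Hom.ext
      (ModuleCat.hom_ext (TensorProduct.ext_threefold fun _ _ _ => rfl))
    leftUnitor_eq := fun _ => RMod.Hom.ext (ModuleCat.hom_ext (TensorProduct.ext' fun _ _ => rfl))
    rightUnitor_eq := fun _ =>
      RMod.Hom.ext (ModuleCat.hom_ext (TensorProduct.ext' fun _ _ => rfl)) }

/-- The monoidal category of extensions of a multiplier bialgebra. -/
@[reducible] noncomputable def monoidal : MonoidalCategory (AExt A.alg) :=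
  letI := monoidalStruct c
  letI := LMod.monoidal c
  Monoidal.induced (toLMod A.alg) (inducingDataL c)

theorem isStrictMonoidal_toLMod : letI := monoidal c; letI := LMod.monoidal c
    IsStrictMonoidal (toLMod A.alg) :=
  letI := monoidalStruct c
  letI := LMod.monoidal c
  IsStrictMonoidal.of_induced (toLMod A.alg) (inducingDataL c) rfl (fun _ _ => rfl) rfl
    (fun _ _ => rfl)

/-- The structure induced along `toRMod` has the same operations as the one induced along `toLMod`.
The axioms being propositions, the two are definitionally equal. -/
theorem isStrictMonoidal_toRMod : letI := monoidal c; letI := RMod.monoidal c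
    IsStrictMonoidal (toRMod A.alg) :=
  letI := monoidalStruct c
  letI := RMod.monoidal c
  IsStrictMonoidal.of_induced (toRMod A.alg) (inducingDataR c) rfl (fun _ _ => rfl) rfl
    (fun _ _ => rfl)

/-- The algebra accounts for the multiplication and the two modules for the two actions; nothing
else is data. -/
theorem eq_of_toLMod_toRMod {A : NUAlg k} {P Q : AExt A} (h : P.alg = Q.alg)
    (hl : (toLMod A).obj P = (toLMod A).obj Q) (hr : (toRMod A).obj P = (toRMod A).obj Q) :
    P = Q := by
  obtain ⟨P, p, _⟩ := P
  obtain ⟨Q, q, _⟩ := Q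
  dsimp only at h
  subst h
  obtain rfl : p = q := ExtStr.ext (LinearMap.ext₂ (LMod.act_eq_of_eq hl rfl))
    (LinearMap.ext₂ (RMod.act_eq_of_eq hr rfl))
  rfl

/-- An extension with given underlying algebra is given by an extension structure on it. -/
theorem exists_eq_ofHom {A B : NdI k} (P : AExt A.alg) (h : P.alg = B.alg) :
    ∃ f : A ⟶ B, P = ofHom f := by
  obtain ⟨P, p, _⟩ := P
  dsimp only at h
  subst h
  exact ⟨p, rfl⟩

theorem ofHom_injective {A B : NdI k} {f g : A ⟶ B} (h : ofHom f = ofHom g) : f = g := by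
  have h' := (AExt.mk.injEq _ _ _ _ _ _).mp h
  exact eq_of_heq h'.2

theorem toLMod_ofHom {A B : NdI k} (f : A ⟶ B) :
    (toLMod A.alg).obj (ofHom f) = LMod.res f (LMod.regular B) :=
  (LMod.ext_act (M := LMod.res f (LMod.regular B)) (N := (toLMod A.alg).obj (ofHom f)) rfl
    (LMod.res_regular_act f)).symm

theorem toRMod_ofHom {A B : NdI k} (f : A ⟶ B) :
    (toRMod A.alg).obj (ofHom f) = RMod.res f (RMod.regular B) :=
  (RMod.ext_act (M := RMod.res f (RMod.regular B)) (N := (toRMod A.alg).obj (ofHom f)) rfl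
    (RMod.res_regular_act f)).symm

/-- The external product of the identity extensions is the identity of `A ⊗ A`, so composing with it
changes nothing. -/
theorem tensor_self (Δ : A ⟶ A ⊗ A) : tensor Δ (self A) (self A) = ofHom Δ :=
  congrArg ofHom (Category.comp_id Δ)

end AExt

/-! ### The bijective correspondence -/

namespace MonoidalLift

variable {A : NdI k}

theorem ext_monoidal {A : NUAlg k} {L L' : MonoidalLift A} (hL : L.monL = L'.monL)
    (hR : L.monR = L'.monR) (hE : L.monE = L'.monE) : L = L' := by
  cases L
  cases L'
  dsimp only at hL hR hE
  subst hL hR hE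
  rfl

/-- The monoidal structures defined by a multiplier bialgebra. -/
noncomputable def ofComonObj (c : ComonObj A) : MonoidalLift A.alg where
  monL := LMod.monoidal c
  monR := RMod.monoidal c
  monE := AExt.monoidal c
  strict_forgetL := LMod.isStrictMonoidal_forget c
  strict_forgetR := RMod.isStrictMonoidal_forget c
  strict_toLMod := AExt.isStrictMonoidal_toLMod c
  strict_toRMod := AExt.isStrictMonoidal_toRMod c
  tensor_alg _ _ := rfl
  unit_alg := rfl

theorem ofComonObj_tensor_self (c : ComonObj A) :
    (ofComonObj c).monE.tensorObj (AExt.self A) (AExt.self A) = AExt.ofHom c.comul :=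
  AExt.tensor_self c.comul

theorem ofComonObj_unit (c : ComonObj A) :
    (ofComonObj c).monE.tensorUnit = AExt.ofHom c.counit := rfl

theorem ofComonObj_injective : Function.Injective (ofComonObj (A := A)) := by
  intro c d h
  have h₁ : c.comul = d.comul := AExt.ofHom_injective (by
    rw [← ofComonObj_tensor_self, h, ofComonObj_tensor_self])
  have h₂ : c.counit = d.counit := AExt.ofHom_injective (by
    rw [← ofComonObj_unit, h, ofComonObj_unit])
  cases c
  cases d
  dsimp only at h₁ h₂
  subst h₁ h₂
  rfl

theorem ofComonObj_surjective : Function.Surjective (ofComonObj (A := A)) := by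
  intro L
  let := L.monL
  let := L.monR
  let := L.monE
  -- The prescribed underlying algebras are what make `Δ` and `ε` morphisms of `NdI k`.
  obtain ⟨Δ, hΔ⟩ := AExt.exists_eq_ofHom (B := A ⊗ A) (AExt.self A ⊗ AExt.self A)
    (L.tensor_alg (AExt.self A) (AExt.self A))
  obtain ⟨ε, hε⟩ := AExt.exists_eq_ofHom (B := 𝟙_ (NdI k)) (𝟙_ (AExt A.alg)) L.unit_alg
  have hL : ∀ M N : LMod A.alg, M ⊗ N = LMod.tensor Δ M N :=
    LMod.tensorObj_eq L.monL L.strict_forgetL Δ (by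
      refine (L.strict_toLMod.tensor_eq (AExt.self A) (AExt.self A)).trans ?_
      rw [hΔ]
      exact AExt.toLMod_ofHom Δ)
  have hR : ∀ M N : RMod A.alg, M ⊗ N = RMod.tensor Δ M N :=
    RMod.tensorObj_eq L.monR L.strict_forgetR Δ (by
      refine (L.strict_toRMod.tensor_eq (AExt.self A) (AExt.self A)).trans ?_
      rw [hΔ]
      exact AExt.toRMod_ofHom Δ)
  have uL : 𝟙_ (LMod A.alg) = LMod.unit ε := by
    rw [L.strict_toLMod.unit_eq, hε]; rfl
  have uR : 𝟙_ (RMod A.alg) = RMod.unit ε := by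
    rw [L.strict_toRMod.unit_eq, hε]; rfl
  -- Strictness of both functors to modules fixes the two actions, and `tensor_alg` fixes the
  -- algebra.
  have hE : ∀ P Q : AExt A.alg, P ⊗ Q = AExt.tensor Δ P Q := fun P Q =>
    AExt.eq_of_toLMod_toRMod (L.tensor_alg P Q)
      ((L.strict_toLMod.tensor_eq P Q).symm.trans (hL _ _))
      ((L.strict_toRMod.tensor_eq P Q).symm.trans (hR _ _))
  let c : ComonObj A := LMod.comonObj L.monL L.strict_forgetL Δ ε hL uL
  have eL : (ofComonObj c).monL = L.monL :=
    IsStrictMonoidal.monoidalCategory_eq (LMod.forget A.alg) _ _ (ofComonObj c).strict_forgetL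
      L.strict_forgetL (fun M N => (hL M N).symm) uL.symm
  have eR : (ofComonObj c).monR = L.monR :=
    IsStrictMonoidal.monoidalCategory_eq (RMod.forget A.alg) _ _ (ofComonObj c).strict_forgetR
      L.strict_forgetR (fun M N => (hR M N).symm) uR.symm
  refine ⟨c, ext_monoidal eL eR ?_⟩
  -- The comparison needs one monoidal structure on the target of `toLMod`, hence the rewriting
  -- along `eL`.
  have sE := (ofComonObj c).strict_toLMod
  rw [eL] at sE
  exact IsStrictMonoidal.monoidalCategory_eq (AExt.toLMod A.alg) _ _ sE L.strict_toLMod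
    (fun P Q => (hE P Q).symm) hε.symm

end MonoidalLift

end MultBialg

theorem theorem2p9 {k : Type u} [CommRing k] (A : MultBialg.NdI k) :
    ∃ e : ComonObj A ≃ MultBialg.MonoidalLift A.alg, ∀ c : ComonObj A,
      (e c).monE.tensorObj (MultBialg.AExt.self A) (MultBialg.AExt.self A) =
        MultBialg.AExt.ofHom c.comul ∧
      (e c).monE.tensorUnit = MultBialg.AExt.ofHom c.counit :=
  ⟨Equiv.ofBijective MultBialg.MonoidalLift.ofComonObj
    ⟨MultBialg.MonoidalLift.ofComonObj_injective, MultBialg.MonoidalLift.ofComonObj_surjective⟩,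
    fun c => ⟨MultBialg.MonoidalLift.ofComonObj_tensor_self c,
      MultBialg.MonoidalLift.ofComonObj_unit c⟩⟩
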